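/- Let $\mathcal G_1$ be the set of linear functionals $\mu:\mathbb C[X]\to\mathbb C$ with $\mu(1)=\mu(X)=1$. For $\mu\in\mathcal G_1$ let $M_\mu(z)=\sum_{n\ge1}\mu(X^n)z^n$, and let $$S_\mu(z)=\frac{1+z}{z}\,M_\mu^{\langle -1\rangle}(z)\in\mathbb C[[z]]$$ be Voiculescu's $S$-transform, where $M_\mu^{\langle -1\rangle}$ is the inverse of $M_\mu$ under composition; $S_\mu$ has constant term $1$, and $\log S_\mu=-\sum_{n\ge1}\frac1n(1-S_\mu)^n$. Let $R_\mu(z)=\sum_{n\ge1}\alpha_nz^n$ be the $R$-transform of $\mu$, determined by $\mu(X^n)=\sum_{\pi\in NC(n)}\prod_{B\in\pi}\alpha_{|B|}$ for all $n\ge1$, where $NC(n)$ is the set of non-crossing partitions of $\{1,\dots,n\}$. Let $\mathcal Y=\mathbb C[Y_n\mid n\ge2]$ be the graded connected Hopf algebra in which $Y_n$ has degree $n-1$, with counit the algebra homomorphism $\varepsilon$ with $\varepsilon(Y_n)=0$ for $n\ge2$, and comultiplication the unital algebra homomorphism $\Delta$ with $$\Delta(Y_n)=\sum_{\pi\in NC(n)}Y_\pi\otimes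 Y_{K(\pi)}\quad(n\ge2),\qquad Y_\pi:=\prod_{B\in\pi}Y_{|B|},\quad Y_1:=1,$$ where $K(\pi)$ is the Kreweras complement of $\pi$. Linear functionals on $\mathcal Y$ are multiplied by convolution, $\xi\eta=\mathrm{Mult}\circ(\xi\otimes\eta)\circ\Delta$, with unit $\varepsilon$. For a linear functional $\eta$ on $\mathcal Y$ with $\eta(1)=1$, put $\log\eta=-\sum_{\ell\ge1}\frac1\ell(\varepsilon-\eta)^\ell$; on elements of degree $d$ only the terms with $\ell\le d$ contribute. Let $\chi_\mu:\mathcal Y\to\mathbb C$ be the unital algebra homomorphism with $\chi_\mu(Y_n)=\alpha_n$ for $n\ge2$, and define $$LS_\mu(z)=\sum_{n=2}^\infty\big((\log\chi_\mu)(Y_n)\big)z^n .$$ Theorem. For every $\mu\in\mathcal G_1$ one has, in $\mathbb C[[z]]$, $$LS_\mu(z)=-z\log S_\mu(z).$$ -/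

import Mathlib

open scoped TensorProduct

namespace LSTransform

/-! ### Non-crossing partitions -/

/-- A partition of an initial segment of the integers is non-crossing when there are no
`a < b < c < d` with `a, c` in one block and `b, d` in a different block. -/
def IsNoncrossing {n : ℕ} (π : Finpartition (Finset.univ : Finset (Fin n))) : Prop :=
  ∀ B ∈ π.parts, ∀ C ∈ π.parts, ∀ a b c d : Fin n, a < b → b < c → c < d →
    a ∈ B → c ∈ B → b ∈ C → d ∈ C → B = C

open Classical in
/-- The set `NC(n)` of non-crossing partitions of an `n`-element chain. -/
noncomputable def NC (n : ℕ) : Finset (Finpartition (Finset.univ : Finset (Fin n))) :=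
  Finset.univ.filter IsNoncrossing

theorem part_formPerm {n : ℕ} (π : Finpartition (Finset.univ : Finset (Fin n))) (i : Fin n) :
    π.part (((π.part i).sort (· ≤ ·)).formPerm i) = π.part i := by
  apply π.part_eq_of_mem (π.part_mem.2 (Finset.mem_univ i))
  have h : i ∈ (π.part i).sort (· ≤ ·) := by simp
  exact (Finset.mem_sort _).1 (List.formPerm_apply_mem_of_mem h)

theorem part_formPerm_inv {n : ℕ} (π : Finpartition (Finset.univ : Finset (Fin n)))
    (i : Fin n) : π.part (((π.part i).sort (· ≤ ·)).formPerm⁻¹ i) = π.part i := by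
  apply π.part_eq_of_mem (π.part_mem.2 (Finset.mem_univ i))
  have h : i ∈ (π.part i).sort (· ≤ ·) := by simp
  rw [← List.formPerm_reverse]
  exact (Finset.mem_sort _).1 (List.mem_reverse.1
    (List.formPerm_apply_mem_of_mem (List.mem_reverse.2 h)))

/-- The permutation `P_π` of a partition `π`: on every block `{b₁ < ⋯ < bₘ}` it acts as the
cycle `b₁ ↦ b₂ ↦ ⋯ ↦ bₘ ↦ b₁`. -/
def blockPerm {n : ℕ} (π : Finpartition (Finset.univ : Finset (Fin n))) :
    Equiv.Perm (Fin n) where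
  toFun i := ((π.part i).sort (· ≤ ·)).formPerm i
  invFun i := ((π.part i).sort (· ≤ ·)).formPerm⁻¹ i
  left_inv i := by beta_reduce; rw [part_formPerm]; simp
  right_inv i := by beta_reduce; rw [part_formPerm_inv]; simp

open Classical in
/-- The Kreweras complement `K(π)`, the non-crossing partition with
`P_{K(π)} = P_π⁻¹ P_{1_n}`, where `P_{1_n}` is the full cycle `0 ↦ 1 ↦ ⋯ ↦ n - 1 ↦ 0`.
As the blocks of a partition are the cycles of its permutation, its blocks are the
cycles (fixed points included) of `P_π⁻¹ P_{1_n}`. -/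
noncomputable def kreweras {n : ℕ} (π : Finpartition (Finset.univ : Finset (Fin n))) :
    Finpartition (Finset.univ : Finset (Fin n)) :=
  Finpartition.ofSetoid (Equiv.Perm.SameCycle.setoid ((blockPerm π)⁻¹ * finRotate n))

/-! ### Distributions, free cumulants and the `R`- and `S`-transforms -/

/-- The set `𝒢₁` of distributions of mean one: linear functionals `μ` on `ℂ[X]` with
`μ(1) = 1` and `μ(X) = 1`. -/
def G1 : Set (Polynomial ℂ →ₗ[ℂ] ℂ) :=
  {μ | μ 1 = 1 ∧ μ Polynomial.X = 1}

open Classical in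
/-- The free cumulants of `μ`, by solving the moment-cumulant formula
`μ(Xⁿ) = ∑_{π ∈ NC(n)} ∏_{B ∈ π} κ_{|B|}` recursively: all blocks of a partition have fewer
than `n` elements, except for the partition with one block. -/
noncomputable def freeCumulant (μ : Polynomial ℂ →ₗ[ℂ] ℂ) (n : ℕ) : ℂ :=
  μ (Polynomial.X ^ n) - ∑ π ∈ (NC n).filter (fun π => ∀ B ∈ π.parts, B.card < n),
    ∏ B ∈ π.parts, if _h : B.card < n then freeCumulant μ B.card else 1
termination_by n
decreasing_by exact _h

/-- A sum over `NC(n)` splits into the one-block partition and the partitions all of whose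
blocks have fewer than `n` elements. -/
theorem sum_NC_split {n : ℕ} (hn : 1 ≤ n) (f : ℕ → ℂ) :
    open Classical in
    ∑ π ∈ NC n, ∏ B ∈ π.parts, f B.card =
      f n + ∑ π ∈ (NC n).filter (fun π => ∀ B ∈ π.parts, B.card < n),
        ∏ B ∈ π.parts, f B.card := by
  classical
  rw [← Finset.sum_filter_add_sum_filter_not (NC n) (fun π => ∀ B ∈ π.parts, B.card < n),
    add_comm]
  congr 1
  have hne : (Finset.univ : Finset (Fin n)) ≠ ⊥ := by
    have : Nonempty (Fin n) := ⟨⟨0, hn⟩⟩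
    exact Finset.univ_nonempty.ne_empty
  have key : (NC n).filter (fun π => ¬ ∀ B ∈ π.parts, B.card < n) =
      {Finpartition.indiscrete hne} := by
    ext π
    simp only [NC, Finset.mem_filter, Finset.mem_univ, true_and, Finset.mem_singleton]
    constructor
    · rintro ⟨-, h⟩
      push Not at h
      obtain ⟨B, hB, hc⟩ := h
      have hBu : B = Finset.univ :=
        Finset.eq_univ_of_card B (le_antisymm (Finset.card_le_univ B) (by simpa using hc))
      subst hBu
      ext C
      rw [Finpartition.indiscrete_parts, Finset.mem_singleton]
      constructor
      · intro hC
        obtain ⟨x, hx⟩ := π.nonempty_of_mem_parts hC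
        exact π.eq_of_mem_parts hC hB hx (Finset.mem_univ x)
      · rintro rfl
        exact hB
    · rintro rfl
      refine ⟨?_, ?_⟩
      · intro B hB C hC
        rw [Finpartition.indiscrete_parts, Finset.mem_singleton] at hB hC
        intros
        rw [hB, hC]
      · intro h
        simpa using h Finset.univ (by simp)
  rw [key]
  simp

/-- The free cumulants satisfy the moment-cumulant formula. -/
theorem moment_eq_sum_freeCumulant (μ : Polynomial ℂ →ₗ[ℂ] ℂ) {n : ℕ} (hn : 1 ≤ n) :
    μ (Polynomial.X ^ n) = ∑ π ∈ NC n, ∏ B ∈ π.parts, freeCumulant μ B.card := by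
  classical
  rw [sum_NC_split hn, freeCumulant, sub_add_eq_add_sub, eq_sub_iff_add_eq]
  congr 1
  refine Finset.sum_congr rfl fun π hπ => Finset.prod_congr rfl fun B hB => ?_
  rw [dif_pos ((Finset.mem_filter.1 hπ).2 B hB)]

/-- The moment-cumulant formula determines the free cumulants. -/
theorem eq_freeCumulant (μ : Polynomial ℂ →ₗ[ℂ] ℂ) (κ : ℕ → ℂ)
    (hκ : ∀ n, 1 ≤ n → μ (Polynomial.X ^ n) = ∑ π ∈ NC n, ∏ B ∈ π.parts, κ B.card)
    (n : ℕ) (hn : 1 ≤ n) : κ n = freeCumulant μ n := by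
  classical
  induction n using Nat.strong_induction_on with
  | _ n ih =>
    have h1 := hκ n hn
    rw [moment_eq_sum_freeCumulant μ hn, sum_NC_split hn, sum_NC_split hn] at h1
    refine (add_right_cancel (h1.trans ?_)).symm
    congr 1
    refine Finset.sum_congr rfl fun π hπ => Finset.prod_congr rfl fun B hB => ?_
    exact ih B.card ((Finset.mem_filter.1 hπ).2 B hB)
      (Finset.card_pos.2 (π.nonempty_of_mem_parts hB))

/-- The `R`-transform `R_μ(z) = ∑_{n ≥ 1} κ_n zⁿ`. -/
noncomputable def rTransform (μ : Polynomial ℂ →ₗ[ℂ] ℂ) : PowerSeries ℂ :=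
  PowerSeries.mk fun n => if n = 0 then 0 else freeCumulant μ n

/-- The moment series `M_μ(z) = ∑_{n ≥ 1} μ(Xⁿ) zⁿ`. -/
noncomputable def momentSeries (μ : Polynomial ℂ →ₗ[ℂ] ℂ) : PowerSeries ℂ :=
  PowerSeries.mk fun n => if n = 0 then 0 else μ (Polynomial.X ^ n)

theorem isUnit_coeff_one_momentSeries (μ : G1) :
    IsUnit (PowerSeries.coeff 1 (momentSeries μ)) := by
  have h := μ.2.2
  simp [momentSeries, h]

/-- `f(z) / z` for a power series `f` without constant term. -/
noncomputable def divByZ (f : PowerSeries ℂ) : PowerSeries ℂ :=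
  PowerSeries.mk fun n => PowerSeries.coeff (n + 1) f

/-- Voiculescu's `S`-transform `S_μ(z) = ((1 + z) / z) M_μ^{⟨-1⟩}(z)`, where `⟨-1⟩` is the
inverse under composition. -/
noncomputable def sTransform (μ : G1) : PowerSeries ℂ :=
  (1 + PowerSeries.X) *
    divByZ ((momentSeries μ).substInvOfIsUnit (isUnit_coeff_one_momentSeries μ))

/-! ### The Hopf algebra of one variable -/

/-- The algebra `𝒴 = ℂ[Y_n | n ≥ 2]`. -/
abbrev YAlg : Type := MvPolynomial {n : ℕ // 2 ≤ n} ℂ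

/-- The generators `Y_n` for `n ≥ 2`, with the convention `Y_1 = 1`. -/
noncomputable def Y (n : ℕ) : YAlg :=
  if h : 2 ≤ n then MvPolynomial.X ⟨n, h⟩ else 1

/-- `Y_π = ∏_{B ∈ π} Y_{|B|}`. -/
noncomputable def Ypart {n : ℕ} (π : Finpartition (Finset.univ : Finset (Fin n))) : YAlg :=
  ∏ B ∈ π.parts, Y B.card

/-- The comultiplication: the unital algebra homomorphism with
`Δ(Y_n) = ∑_{π ∈ NC(n)} Y_π ⊗ Y_{K(π)}` for `n ≥ 2`. -/
noncomputable def comul : YAlg →ₐ[ℂ] YAlg ⊗[ℂ] YAlg :=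
  MvPolynomial.aeval fun n => ∑ π ∈ NC n.1, Ypart π ⊗ₜ[ℂ] Ypart (kreweras π)

/-- The counit: the unital algebra homomorphism with `ε(Y_n) = 0` for `n ≥ 2`. -/
noncomputable def counit : YAlg →ₐ[ℂ] ℂ :=
  MvPolynomial.aeval fun _ => 0

/-- The convolution `ξη = Mult ∘ (ξ ⊗ η) ∘ Δ` of linear functionals. -/
noncomputable def conv (ξ η : YAlg →ₗ[ℂ] ℂ) : YAlg →ₗ[ℂ] ℂ :=
  LinearMap.mul' ℂ ℂ ∘ₗ TensorProduct.map ξ η ∘ₗ comul.toLinearMap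

/-- Convolution powers, with `ξ⁰ = ε`. -/
noncomputable def convPow (ξ : YAlg →ₗ[ℂ] ℂ) : ℕ → (YAlg →ₗ[ℂ] ℂ)
  | 0 => counit.toLinearMap
  | l + 1 => conv (convPow ξ l) ξ

/-- The degree of a monomial in the grading for which `Y_n` has degree `n - 1`. -/
def monomialDegree (m : {n : ℕ // 2 ≤ n} →₀ ℕ) : ℕ :=
  m.sum fun n k => k * (n.1 - 1)

/-- The logarithm `log η = - ∑_{l ≥ 1} (1/l) (ε - η)^l` of a functional with `η(1) = 1`.
As `(ε - η)^l` vanishes in all degrees smaller than `l`, this is the linear map that agrees on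
the homogeneous elements of degree `d` with the partial sum over `1 ≤ l ≤ d`. -/
noncomputable def logFunctional (η : YAlg →ₗ[ℂ] ℂ) : YAlg →ₗ[ℂ] ℂ :=
  (MvPolynomial.basisMonomials {n : ℕ // 2 ≤ n} ℂ).constr ℂ fun m =>
    -∑ l ∈ Finset.Icc 1 (monomialDegree m),
      (1 / (l : ℂ)) * convPow (counit.toLinearMap - η) l (MvPolynomial.monomial m 1)

/-- The character `χ_μ` with `χ_μ(Y_n)` the coefficient of `zⁿ` in `R_μ`, for `n ≥ 2`. -/
noncomputable def character (μ : G1) : YAlg →ₐ[ℂ] ℂ :=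
  MvPolynomial.aeval fun n => PowerSeries.coeff n.1 (rTransform μ)

/-- The transform `LS_μ(z) = ∑_{n ≥ 2} (log χ_μ)(Y_n) zⁿ`. -/
noncomputable def LS (μ : G1) : PowerSeries ℂ :=
  PowerSeries.mk fun n =>
    if 2 ≤ n then logFunctional (character μ).toLinearMap (Y n) else 0

end LSTransform

namespace LSTransform

open PowerSeries in
theorem hasSubst_of_constantCoeff {u : ℂ⟦X⟧} (hu : constantCoeff u = 0) : HasSubst u :=
  HasSubst.of_constantCoeff_zero' hu

open PowerSeries in
theorem eq_zero_of_eq_mul_succ {E : ℕ → ℂ⟦X⟧} {u : ℂ⟦X⟧} (hu : constantCoeff u = 0)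
    (h : ∀ k, E k = u * E (k + 1)) : E 0 = 0 := by
  have hk : ∀ k, E 0 = u ^ k * E k := by
    intro k
    induction k with
    | zero => simp
    | succ k ih => rw [ih, h k, pow_succ]; ring
  obtain ⟨w, rfl⟩ := X_dvd_iff.2 hu
  ext n
  rw [hk (n + 1), mul_pow, mul_assoc, coeff_X_pow_mul']
  simp

open PowerSeries in
theorem mk_eq_C_add_X_mul (c : ℕ → ℂ) : mk c = C (c 0) + X * mk (fun n => c (n + 1)) := by
  ext n
  cases n <;> simp [coeff_succ_X_mul]

open PowerSeries in
theorem C_subst (u : ℂ⟦X⟧) (r : ℂ) : subst u (C r : ℂ⟦X⟧) = C r :=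
  subst_C r

/-- A sequence with `B k = c k v + u B (k + 1)` is the geometric-type series
`B 0 = (∑ c k uᵏ) v`. -/
theorem eq_subst_mul_of_recursion {B : ℕ → PowerSeries ℂ} {c : ℕ → ℂ} {u v : PowerSeries ℂ}
    (hu : PowerSeries.constantCoeff u = 0)
    (h : ∀ k, B k = PowerSeries.C (c k) * v + u * B (k + 1)) :
    B 0 = (PowerSeries.mk c).subst u * v := by
  have hs := hasSubst_of_constantCoeff hu
  rw [← sub_eq_zero]
  have := eq_zero_of_eq_mul_succ
    (E := fun k => B k - (PowerSeries.mk fun n => c (k + n)).subst u * v) hu (fun k => ?_)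
  · simpa using this
  rw [h k, mk_eq_C_add_X_mul, PowerSeries.subst_add hs, PowerSeries.subst_mul hs,
    PowerSeries.subst_X hs, C_subst]
  simp only [add_zero, ← add_assoc, add_right_comm k _ 1]
  ring

open PowerSeries in
/-- The residue computation behind Lagrange inversion. -/
theorem coeff_X_mul_pow_mul_derivative_mul_inv_pow {T : ℂ⟦X⟧} (hT : constantCoeff T = 1)
    (n k : ℕ) :
    coeff n ((X * T) ^ k * d⁄dX ℂ (X * T) * T⁻¹ ^ (n + 1)) = if n = k then 1 else 0 := by
  have hT0 : constantCoeff T ≠ 0 := by simp [hT]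
  have hTG : T * T⁻¹ = 1 := PowerSeries.mul_inv_cancel T hT0
  have hD : d⁄dX ℂ (X * T) = T + X * d⁄dX ℂ T := by
    rw [Derivation.leibniz, derivative_X]
    simp only [smul_eq_mul, mul_one]
    ring
  rw [hD]
  rcases lt_or_ge n k with hnk | hnk
  · rw [if_neg hnk.ne, mul_pow, mul_assoc, mul_assoc, coeff_X_pow_mul', if_neg (by omega)]
  · obtain ⟨j, rfl⟩ := Nat.exists_eq_add_of_le hnk
    have h1 : (X * T) ^ k * (T + X * d⁄dX ℂ T) * T⁻¹ ^ (k + j + 1) =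
        X ^ k * (T⁻¹ ^ j + X * (T⁻¹ ^ (j + 1) * d⁄dX ℂ T)) := by
      have : (T * T⁻¹) ^ k = 1 := by rw [hTG, one_pow]
      calc _ = X ^ k * (T * T⁻¹) ^ k *
            ((T * T⁻¹) * T⁻¹ ^ j + X * (T⁻¹ ^ (j + 1) * d⁄dX ℂ T)) := by ring
        _ = _ := by rw [this, hTG]; ring
    rw [h1, coeff_X_pow_mul', if_pos (by omega), Nat.add_sub_cancel_left]
    cases j with
    | zero => simp
    | succ j =>
      rw [if_neg (by omega), map_add, coeff_succ_X_mul]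
      have h2 : d⁄dX ℂ (T⁻¹ ^ (j + 1)) = -((j + 1 : ℕ) : ℂ⟦X⟧) * (T⁻¹ ^ (j + 2) * d⁄dX ℂ T) := by
        rw [derivative_pow, derivative_inv']
        simp only [Nat.add_sub_cancel]
        ring
      have h3 := congrArg (coeff j) h2
      rw [coeff_derivative, ← map_natCast (C : ℂ →+* ℂ⟦X⟧), ← map_neg, coeff_C_mul] at h3
      have h4 : ((j : ℂ) + 1) ≠ 0 := by exact_mod_cast Nat.succ_ne_zero j
      apply mul_right_cancel₀ h4
      rw [add_mul, h3]
      push_cast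
      ring

open PowerSeries in
/-- Lagrange inversion for the compositional inverse of `X T`. -/
theorem coeff_of_subst_X_mul_eq_X {φ T : ℂ⟦X⟧} (hT : constantCoeff T = 1)
    (h : φ.subst (X * T) = X) (n : ℕ) :
    ((n : ℂ) + 1) * coeff (n + 1) φ = coeff n (T⁻¹ ^ (n + 1)) := by
  have hs : HasSubst (X * T : ℂ⟦X⟧) := hasSubst_of_constantCoeff (by simp)
  have hd : (d⁄dX ℂ φ).subst (X * T) * d⁄dX ℂ (X * T) = 1 := by
    rw [← derivative_subst hs, h, derivative_X]
  have key : ∀ ψ : ℂ⟦X⟧,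
      coeff n (ψ.subst (X * T) * d⁄dX ℂ (X * T) * T⁻¹ ^ (n + 1)) = coeff n ψ := by
    intro ψ
    have hψ : ψ = ∑ k ∈ Finset.range (n + 1), C (coeff k ψ) * X ^ k +
        X ^ (n + 1) * mk (fun j => coeff (j + (n + 1)) ψ) := by
      ext m
      simp only [map_add, map_sum, coeff_C_mul, coeff_X_pow, coeff_X_pow_mul', coeff_mk,
        mul_ite, mul_one, mul_zero, Finset.sum_ite_eq, Finset.mem_range]
      by_cases hm : m < n + 1
      · rw [if_pos hm, if_neg (by omega), add_zero]
      · rw [if_neg hm, if_pos (by omega), zero_add, Nat.sub_add_cancel (by omega)]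
    conv_lhs => rw [hψ]
    rw [← coe_substAlgHom hs, map_add (substAlgHom hs), map_mul (substAlgHom hs) (X ^ (n + 1)),
      map_pow, map_sum, add_mul, add_mul, map_add, substAlgHom_X hs, Finset.sum_mul,
      Finset.sum_mul, map_sum]
    have hrest : coeff n ((X * T) ^ (n + 1) *
        substAlgHom hs (mk fun j => coeff (j + (n + 1)) ψ) * d⁄dX ℂ (X * T) *
          T⁻¹ ^ (n + 1)) = 0 := by
      rw [mul_pow, mul_assoc, mul_assoc, mul_assoc, coeff_X_pow_mul', if_neg (by omega)]
    rw [hrest, add_zero, Finset.sum_eq_single n]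
    · rw [map_mul (substAlgHom hs), map_pow, substAlgHom_X hs, coe_substAlgHom, C_subst, mul_assoc, mul_assoc,
        coeff_C_mul, ← mul_assoc, coeff_X_mul_pow_mul_derivative_mul_inv_pow hT, if_pos rfl,
        mul_one]
    · intro k _ hk
      rw [map_mul (substAlgHom hs), map_pow, substAlgHom_X hs, coe_substAlgHom, C_subst,
        mul_assoc, mul_assoc,
        coeff_C_mul, ← mul_assoc, coeff_X_mul_pow_mul_derivative_mul_inv_pow hT,
        if_neg hk.symm, mul_zero]
    · simp
  rw [← one_mul (T⁻¹ ^ (n + 1)), ← hd, key, coeff_derivative, mul_comm]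

open PowerSeries in
theorem derivative_logOf_mul {f : ℂ⟦X⟧} (hf : constantCoeff f = 1) :
    d⁄dX ℂ (logOf f) * f = d⁄dX ℂ f := by
  have hs : HasSubst (f - 1 : ℂ⟦X⟧) := hasSubst_of_constantCoeff (by simp [hf])
  have h1 : d⁄dX ℂ (log ℂ) * (1 + X) = 1 := by
    rw [deriv_log]
    ext n
    rw [mul_add, mul_one, map_add]
    cases n with
    | zero => simp
    | succ n => rw [coeff_succ_mul_X]; simp [pow_succ, coeff_one]
  have h2 := congrArg (subst (f - 1)) h1
  rw [subst_mul hs, subst_add hs, subst_X hs, ← map_one (C : ℂ →+* ℂ⟦X⟧), C_subst, map_one,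
    add_sub_cancel] at h2
  rw [logOf_eq, derivative_subst hs, map_sub, derivative_one, sub_zero, mul_right_comm, h2,
    one_mul]

open PowerSeries in
theorem logOf_inv_pow {T : ℂ⟦X⟧} (hT : constantCoeff T = 1) (n : ℕ) :
    logOf (T⁻¹ ^ n) = -(C (n : ℂ) * logOf T) := by
  have hT0 : constantCoeff T ≠ 0 := by simp [hT]
  have hTG : T * T⁻¹ = 1 := PowerSeries.mul_inv_cancel T hT0
  have hG : constantCoeff (T⁻¹ ^ n) = 1 := by simp [hT]
  apply derivative.ext
  · have h1 := derivative_logOf_mul hG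
    have h2 := derivative_logOf_mul hT
    have hne : T⁻¹ ^ n ≠ 0 := fun h0 => by rw [h0] at hG; simp at hG
    apply mul_right_cancel₀ hne
    rw [h1, derivative_pow, derivative_inv', ← h2, map_neg, Derivation.leibniz, derivative_C,
      map_natCast]
    simp only [smul_eq_mul, mul_zero, add_zero]
    cases n with
    | zero => simp
    | succ n =>
      simp only [Nat.add_sub_cancel]
      calc _ = -(((n + 1 : ℕ) : ℂ⟦X⟧) * d⁄dX ℂ (logOf T) * T⁻¹ ^ (n + 1)) * (T * T⁻¹) := by ring
        _ = _ := by rw [hTG]; ring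
  · rw [constantCoeff_logOf hG, map_neg, map_mul, constantCoeff_logOf hT]
    simp

open PowerSeries in
theorem coeff_logOf {G : ℂ⟦X⟧} (hG : constantCoeff G = 1) (n : ℕ) :
    coeff n (logOf G) = -∑ l ∈ Finset.Icc 1 n, (1 / (l : ℂ)) * coeff n ((1 - G) ^ l) := by
  have h0 : constantCoeff (G - 1) = 0 := by simp [hG]
  have hs : HasSubst (G - 1 : ℂ⟦X⟧) := hasSubst_of_constantCoeff h0
  rw [logOf_eq, coeff_subst' hs, finsum_eq_sum_of_support_subset (s := Finset.Icc 1 n),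
    ← Finset.sum_neg_distrib]
  · refine Finset.sum_congr rfl fun l hl => ?_
    have hl1 : l ≠ 0 := by have := Finset.mem_Icc.1 hl; omega
    have hneg : (G - 1) ^ l = C ((-1) ^ l) * (1 - G) ^ l := by
      rw [← neg_sub 1 G, neg_pow, map_pow, map_neg, map_one]
    rw [coeff_log, if_neg hl1, hneg, coeff_C_mul, smul_eq_mul]
    simp only [map_div₀, map_pow, map_neg, map_one, map_natCast]
    have : ((-1 : ℂ)) ^ l * (-1) ^ l = 1 := by rw [← mul_pow]; simp
    rw [pow_succ]
    linear_combination (-(1 / (l : ℂ)) * coeff n ((1 - G) ^ l)) * this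
  · intro l hl
    rw [Function.mem_support] at hl
    simp only [Finset.coe_Icc, Set.mem_Icc]
    constructor
    · by_contra h
      apply hl
      have : l = 0 := by omega
      simp [this]
    · by_contra h
      apply hl
      obtain ⟨w, hw⟩ := X_dvd_iff.2 h0
      rw [hw, mul_pow, coeff_X_pow_mul', if_neg h, smul_zero]

open Equiv

section Cycles

variable {α : Type*} [Fintype α] [DecidableEq α]

open Classical in
/-- The cycle of `x` under `σ`, as a finset. -/
noncomputable def cycleFinset (σ : Perm α) (x : α) : Finset α :=
  Finset.univ.filter (σ.SameCycle x)

theorem mem_cycleFinset {σ : Perm α} {x y : α} : y ∈ cycleFinset σ x ↔ σ.SameCycle x y := by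
  simp [cycleFinset]

theorem cycleFinset_eq_iff {σ : Perm α} {x y : α} :
    cycleFinset σ x = cycleFinset σ y ↔ σ.SameCycle x y := by
  constructor
  · intro h
    rw [← mem_cycleFinset, h, mem_cycleFinset]
  · intro h
    ext z
    rw [mem_cycleFinset, mem_cycleFinset]
    exact ⟨fun h' => h.symm.trans h', fun h' => h.trans h'⟩

/-- The product of `f` over the cycles of `σ` that meet `I`, where a cycle is measured by the
sum of `ω` over its elements. -/
noncomputable def cycleWeight (f : ℕ → ℂ) (ω : α → ℕ) (I : Finset α) (σ : Perm α) : ℂ :=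
  ∏ B ∈ I.image (cycleFinset σ), f (∑ x ∈ B, ω x)

omit [Fintype α] in
theorem prod_image_congr {β γ : Type*} [DecidableEq β] [DecidableEq γ] (I : Finset α)
    (F : α → β) (G : α → γ) (h : β → ℂ) (k : γ → ℂ)
    (h1 : ∀ x ∈ I, ∀ y ∈ I, F x = F y ↔ G x = G y) (h2 : ∀ x ∈ I, h (F x) = k (G x)) :
    ∏ b ∈ I.image F, h b = ∏ c ∈ I.image G, k c := by
  induction I using Finset.induction_on with
  | empty => simp
  | insert a s ha ih =>
    have ih' := ih (fun x hx y hy => h1 x (Finset.mem_insert_of_mem hx) y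
      (Finset.mem_insert_of_mem hy)) (fun x hx => h2 x (Finset.mem_insert_of_mem hx))
    have hiff : F a ∈ s.image F ↔ G a ∈ s.image G := by
      simp only [Finset.mem_image]
      exact exists_congr fun x => and_congr_right fun hx =>
        h1 x (Finset.mem_insert_of_mem hx) a (Finset.mem_insert_self a s)
    rw [Finset.image_insert, Finset.image_insert]
    by_cases hm : F a ∈ s.image F
    · rw [Finset.insert_eq_of_mem hm, Finset.insert_eq_of_mem (hiff.1 hm), ih']
    · rw [Finset.prod_insert hm, Finset.prod_insert (fun hg => hm (hiff.2 hg)), ih',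
        h2 a (Finset.mem_insert_self a s)]

omit [DecidableEq α] in
theorem sameCycle_le {σ : Perm α} {r : α → α → Prop} (hr : Equivalence r)
    (h : ∀ x, r x (σ x)) {x y : α} (hxy : σ.SameCycle x y) : r x y := by
  obtain ⟨n, rfl⟩ := hxy.exists_nat_pow_eq
  induction n with
  | zero => exact hr.refl x
  | succ n ih =>
    rw [pow_succ', Perm.mul_apply]
    exact hr.trans (ih ⟨n, by simp⟩) (h _)

omit [DecidableEq α] in
theorem sameCycle_of_agree {σ τ : Perm α} {I : Finset α} (h : ∀ x ∈ I, σ x = τ x ∧ σ x ∈ I)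
    {x y : α} (hx : x ∈ I) (hxy : σ.SameCycle x y) : τ.SameCycle x y ∧ y ∈ I := by
  obtain ⟨n, rfl⟩ := hxy.exists_nat_pow_eq
  have key : (σ ^ n) x = (τ ^ n) x ∧ (σ ^ n) x ∈ I := by
    clear hxy
    induction n with
    | zero => exact ⟨rfl, hx⟩
    | succ n ih =>
      rw [pow_succ', pow_succ', Perm.mul_apply, Perm.mul_apply, ← ih.1]
      exact h _ ih.2
  exact ⟨⟨n, by simp [key.1]⟩, key.2⟩

theorem cycleFinset_congr {σ τ : Perm α} {I : Finset α} (h : ∀ x ∈ I, σ x = τ x ∧ σ x ∈ I)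
    {x : α} (hx : x ∈ I) : cycleFinset σ x = cycleFinset τ x := by
  ext y
  rw [mem_cycleFinset, mem_cycleFinset]
  exact ⟨fun hy => (sameCycle_of_agree h hx hy).1, fun hy => (sameCycle_of_agree
    (fun z hz => ⟨(h z hz).1.symm, (h z hz).1 ▸ (h z hz).2⟩) hx hy).1⟩

theorem cycleWeight_congr (f : ℕ → ℂ) {σ τ : Perm α} {I : Finset α}
    (h : ∀ x ∈ I, σ x = τ x ∧ σ x ∈ I) {ω ω' : α → ℕ} (hω : ∀ x ∈ I, ω x = ω' x) :
    cycleWeight f ω I σ = cycleWeight f ω' I τ := by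
  refine prod_image_congr I _ _ _ _ (fun x hx y hy => ?_) fun x hx => ?_
  · rw [cycleFinset_congr h hx, cycleFinset_congr h hy]
  · rw [← cycleFinset_congr h hx]
    refine congrArg f (Finset.sum_congr rfl fun y hy => hω y ?_)
    exact (sameCycle_of_agree h hx (mem_cycleFinset.1 hy)).2

theorem cycleWeight_union (f : ℕ → ℂ) {ρ σ τ : Perm α} {I J : Finset α} (hIJ : Disjoint I J)
    (hI : ∀ x ∈ I, ρ x = σ x ∧ ρ x ∈ I) (hJ : ∀ x ∈ J, ρ x = τ x ∧ ρ x ∈ J)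
    {ω ω₁ ω₂ : α → ℕ} (h₁ : ∀ x ∈ I, ω x = ω₁ x) (h₂ : ∀ x ∈ J, ω x = ω₂ x) :
    cycleWeight f ω (I ∪ J) ρ = cycleWeight f ω₁ I σ * cycleWeight f ω₂ J τ := by
  rw [← cycleWeight_congr f hI h₁, ← cycleWeight_congr f hJ h₂]
  unfold cycleWeight
  rw [Finset.image_union, Finset.prod_union]
  rw [Finset.disjoint_left]
  intro B hB hB'
  obtain ⟨x, hx, rfl⟩ := Finset.mem_image.1 hB
  obtain ⟨y, hy, hyx⟩ := Finset.mem_image.1 hB'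
  exact Finset.disjoint_left.1 hIJ
    (sameCycle_of_agree hI hx (cycleFinset_eq_iff.1 hyx.symm)).2 hy

theorem cycleWeight_singleton (f : ℕ → ℂ) (ω : α → ℕ) {σ : Perm α} {a : α} (ha : σ a = a) :
    cycleWeight f ω {a} σ = f (ω a) := by
  have : cycleFinset σ a = {a} := by
    ext y
    rw [mem_cycleFinset, Finset.mem_singleton]
    exact ⟨fun h => (h.eq_of_left ha).symm, fun h => h ▸ Perm.SameCycle.refl _ _⟩
  rw [cycleWeight, Finset.image_singleton, this, Finset.prod_singleton, Finset.sum_singleton]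

/-- Inserting a fixed point `a` of `ρ` into the cycle of `i`. -/
theorem cycleWeight_insert (f : ℕ → ℂ) {ρ : Perm α} {a i j : α} {I : Finset α} (ha : ρ a = a)
    (hij : ρ.SameCycle i j) (hi : i ∈ I) (haI : a ∉ I) (hI : ∀ x ∈ I, ρ x ∈ I)
    {ω ω' : α → ℕ} (hω : ∀ x ∈ I, ω' x = ω x + if x = j then ω a else 0) :
    cycleWeight f ω (insert a I) (swap a i * ρ) = cycleWeight f ω' I ρ := by
  have hai : a ≠ i := fun h => haI (h ▸ hi)
  set σ := swap a i * ρ with hσ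
  have hσa : σ a = i := by rw [hσ, Perm.mul_apply, ha, swap_apply_left]
  have hσi : ∀ x, ρ x = i → σ x = a := fun x hx => by
    rw [hσ, Perm.mul_apply, hx, swap_apply_right]
  have hσo : ∀ x, ρ x ≠ i → x ≠ a → σ x = ρ x := fun x hx hxa => by
    rw [hσ, Perm.mul_apply, swap_apply_of_ne_of_ne _ hx]
    exact fun h => hxa (ρ.injective (h.trans ha.symm))
  have hai' : σ.SameCycle a i := ⟨1, by simp [hσa]⟩
  have hback : ∀ x y, ρ.SameCycle x y → σ.SameCycle x y := fun x y => by
    refine sameCycle_le (Perm.SameCycle.equivalence σ) fun z => ?_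
    by_cases hza : z = a
    · rw [hza, ha]
    · by_cases hzi : ρ z = i
      · rw [hzi]
        exact Perm.SameCycle.trans ⟨1, by simp [hσi z hzi]⟩ hai'
      · exact ⟨1, by simp [hσo z hzi hza]⟩
  let p : α → α := fun z => if z = a then i else z
  have hforw : ∀ x y, σ.SameCycle x y → ρ.SameCycle (p x) (p y) := fun x y => by
    refine sameCycle_le (r := fun x y => ρ.SameCycle (p x) (p y))
      ⟨fun _ => Perm.SameCycle.refl _ _, fun h => h.symm, fun h h' => h.trans h'⟩ fun z => ?_
    by_cases hza : z = a
    · rw [hza, hσa]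
      simp [p, Perm.SameCycle.refl]
    · by_cases hzi : ρ z = i
      · rw [hσi z hzi]
        simp only [p, if_neg hza, if_true]
        exact ⟨1, by simp [hzi]⟩
      · rw [hσo z hzi hza]
        have : ρ z ≠ a := fun h => hza (ρ.injective (h.trans ha.symm))
        simp only [p, if_neg hza, if_neg this]
        exact ⟨1, by simp⟩
  have hpne : ∀ x, x ≠ a → p x = x := fun x hx => if_neg hx
  have hiff : ∀ x y, x ≠ a → y ≠ a → (σ.SameCycle x y ↔ ρ.SameCycle x y) := fun x y hx hy =>
    ⟨fun h => by simpa only [hpne x hx, hpne y hy] using hforw x y h, hback x y⟩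
  have hiffa : ∀ x, x ≠ a → (σ.SameCycle x a ↔ ρ.SameCycle x j) := fun x hx =>
    ⟨fun h => by
      have := hforw x a h
      rw [hpne x hx] at this
      simp only [p, if_true] at this
      exact this.trans hij,
    fun h => (hback x i (h.trans hij.symm)).trans hai'.symm⟩
  have hne : ∀ x ∈ I, x ≠ a := fun x hx h => haI (h ▸ hx)
  unfold cycleWeight
  rw [Finset.image_insert, Finset.insert_eq_of_mem
    (Finset.mem_image.2 ⟨i, hi, cycleFinset_eq_iff.2 hai'.symm⟩)]
  refine prod_image_congr I _ _ _ _ (fun x hx y hy => ?_) fun x hx => ?_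
  · rw [cycleFinset_eq_iff, cycleFinset_eq_iff, hiff x y (hne x hx) (hne y hy)]
  · congr 1
    have hsub : ∀ y ∈ cycleFinset ρ x, y ∈ I := fun y hy =>
      (sameCycle_of_agree (fun z hz => ⟨rfl, hI z hz⟩) hx (mem_cycleFinset.1 hy)).2
    rw [Finset.sum_congr rfl fun y hy => hω y (hsub y hy), Finset.sum_add_distrib,
      Finset.sum_ite_eq']
    by_cases hj : ρ.SameCycle x j
    · have : cycleFinset σ x = insert a (cycleFinset ρ x) := by
        ext y
        rw [Finset.mem_insert, mem_cycleFinset, mem_cycleFinset]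
        by_cases hya : y = a
        · simp [hya, (hiffa x (hne x hx)).2 hj]
        · simp [hya, hiff x y (hne x hx) hya]
      rw [this, Finset.sum_insert (fun h => haI (hsub a h)), if_pos (mem_cycleFinset.2 hj),
        add_comm]
    · have : cycleFinset σ x = cycleFinset ρ x := by
        ext y
        rw [mem_cycleFinset, mem_cycleFinset]
        by_cases hya : y = a
        · rw [hya, hiffa x (hne x hx)]
          exact ⟨fun h => absurd h hj, fun h =>
            absurd (hsub a (mem_cycleFinset.2 h)) haI⟩
        · exact hiff x y (hne x hx) hya
      rw [this, if_neg (fun h => hj (mem_cycleFinset.1 h)), add_zero]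

omit [DecidableEq α] in
theorem exists_restrict (σ : Perm α) (I : Finset α) (h : ∀ x ∈ I, σ x ∈ I) :
    ∃ τ : Perm α, (∀ x ∈ I, τ x = σ x) ∧ ∀ x ∉ I, τ x = x := by
  classical
  have hinj : Function.Injective fun x => if x ∈ I then σ x else x := by
    intro x y hxy
    simp only at hxy
    split_ifs at hxy with hx hy hy
    · exact σ.injective hxy
    · exact absurd (hxy ▸ h x hx) hy
    · exact absurd (hxy.symm ▸ h y hy) hx
    · exact hxy
  refine ⟨Equiv.ofBijective _ (Finite.injective_iff_bijective.1 hinj), fun x hx => ?_,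
    fun x hx => ?_⟩
  · simp [hx]
  · simp [hx]

omit [DecidableEq α] in
theorem mem_of_apply_mem {σ : Perm α} {I : Finset α} (h : ∀ x ∈ I, σ x ∈ I) {x : α}
    (hx : σ x ∈ I) : x ∈ I := by
  obtain ⟨τ, h1, h2⟩ := exists_restrict σ I h
  obtain ⟨z, hz⟩ := τ.surjective (σ x)
  have hzI : z ∈ I := by
    by_contra hzI
    rw [h2 z hzI] at hz
    exact hzI (hz ▸ hx)
  rw [h1 z hzI] at hz
  exact σ.injective hz ▸ hzI

end Cycles

/-- The elements of `Fin N` in `[a, b)`. -/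
def interval (N a b : ℕ) : Finset (Fin N) :=
  Finset.univ.filter fun x => a ≤ (x : ℕ) ∧ (x : ℕ) < b

theorem mem_interval {N a b : ℕ} {x : Fin N} :
    x ∈ interval N a b ↔ a ≤ (x : ℕ) ∧ (x : ℕ) < b := by
  simp [interval]

open Classical in
/-- The permutations of `Fin N` supported in `[a, b)` whose arcs `x ↦ σ x` with `x < σ x` are
not crossed by any arc. -/
noncomputable def NCPerm (N a b : ℕ) : Finset (Perm (Fin N)) :=
  Finset.univ.filter fun σ => (∀ x ∉ interval N a b, σ x = x) ∧
    ∀ x y, x < y → y < σ x → x < σ y ∧ σ y < σ x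

theorem mem_NCPerm {N a b : ℕ} {σ : Perm (Fin N)} :
    σ ∈ NCPerm N a b ↔ (∀ x ∉ interval N a b, σ x = x) ∧
      ∀ x y, x < y → y < σ x → x < σ y ∧ σ y < σ x := by
  simp [NCPerm]

theorem NCPerm_apply_mem {N a b : ℕ} {σ : Perm (Fin N)} (hσ : σ ∈ NCPerm N a b) {x : Fin N}
    (hx : x ∈ interval N a b) : σ x ∈ interval N a b := by
  by_contra h
  have := σ.injective ((mem_NCPerm.1 hσ).1 _ h)
  exact h (this.symm ▸ hx)

/-- The values of the product of noncrossing permutations of `(a, i)` and `[i, b)` with the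
transposition `(a i)`. -/
theorem swap_mul_apply_cases {N b : ℕ} {A i : Fin N} (hi : i ∈ interval N (A + 1) b)
    {ρ τ : Perm (Fin N)} (hρ : ρ ∈ NCPerm N (A + 1) i) (hτ : τ ∈ NCPerm N i b) (x : Fin N) :
    (x < A ∧ (swap A i * (ρ * τ)) x = x) ∨ (x = A ∧ (swap A i * (ρ * τ)) x = i) ∨
    (x ∈ interval N (A + 1) i ∧ (swap A i * (ρ * τ)) x = ρ x ∧ ρ x ∈ interval N (A + 1) i) ∨
    (x ∈ interval N i b ∧ τ x = i ∧ (swap A i * (ρ * τ)) x = A) ∨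
    (x ∈ interval N i b ∧ (swap A i * (ρ * τ)) x = τ x ∧ τ x ∈ interval N i b ∧ τ x ≠ i) ∨
    (b ≤ (x : ℕ) ∧ (swap A i * (ρ * τ)) x = x) := by
  have hi' := mem_interval.1 hi
  simp only [Perm.mul_apply]
  have hρo := (mem_NCPerm.1 hρ).1
  have hτo := (mem_NCPerm.1 hτ).1
  have hsw : ∀ z : Fin N, z ≠ A → z ≠ i → swap A i z = z :=
    fun z h h' => swap_apply_of_ne_of_ne h h'
  by_cases hx2 : x ∈ interval N i b
  · have hm := NCPerm_apply_mem hτ hx2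
    have hm' := mem_interval.1 hm
    have : ρ (τ x) = τ x := hρo _ (by rw [mem_interval]; omega)
    rw [this]
    by_cases hti : τ x = i
    · exact Or.inr (Or.inr (Or.inr (Or.inl ⟨hx2, hti, by rw [hti, swap_apply_right]⟩)))
    · refine Or.inr (Or.inr (Or.inr (Or.inr (Or.inl ⟨hx2, hsw _ ?_ hti, hm, hti⟩))))
      intro h
      rw [h] at hm'
      omega
  · have hτx := hτo x hx2
    rw [hτx]
    by_cases hx1 : x ∈ interval N (A + 1) i
    · have hm := NCPerm_apply_mem hρ hx1
      have hm' := mem_interval.1 hm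
      refine Or.inr (Or.inr (Or.inl ⟨hx1, hsw _ ?_ ?_, hm⟩))
      · intro h
        rw [h] at hm'
        omega
      · intro h
        rw [h] at hm'
        omega
    · rw [hρo x hx1]
      rw [mem_interval] at hx1 hx2
      by_cases hxA : x = A
      · exact Or.inr (Or.inl ⟨hxA, by rw [hxA, swap_apply_left]⟩)
      · have hxA' : (x : ℕ) ≠ A := fun h => hxA (Fin.ext h)
        have hs : swap A i x = x := hsw x hxA (fun h => by rw [h] at hx2; omega)
        by_cases hlt : (x : ℕ) < A
        · exact Or.inl ⟨hlt, hs⟩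
        · exact Or.inr (Or.inr (Or.inr (Or.inr (Or.inr ⟨by omega, hs⟩))))

theorem swap_mul_mem_NCPerm {N b : ℕ} {A i : Fin N} (hi : i ∈ interval N (A + 1) b)
    {ρ τ : Perm (Fin N)} (hρ : ρ ∈ NCPerm N (A + 1) i) (hτ : τ ∈ NCPerm N i b) :
    swap A i * (ρ * τ) ∈ NCPerm N A b := by
  have hc := swap_mul_apply_cases hi hρ hτ
  have hi' := mem_interval.1 hi
  rw [mem_NCPerm]
  constructor
  · intro x hx
    rw [mem_interval] at hx
    rcases hc x with h | h | h | h | h | h <;> try simp only [mem_interval] at h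
    · exact h.2
    · rw [h.1] at hx; omega
    · omega
    · omega
    · omega
    · exact h.2
  · intro x y hxy hyx
    have hρ2 := (mem_NCPerm.1 hρ).2 x y hxy
    have hτ2 := (mem_NCPerm.1 hτ).2 x y hxy
    have hcx := hc x
    have hcy := hc y
    generalize (swap A i * (ρ * τ)) x = u at *
    generalize (swap A i * (ρ * τ)) y = v at *
    simp only [mem_interval, Fin.lt_def, Fin.ext_iff, ne_eq] at *
    omega

theorem exists_swap_mul_eq {N b : ℕ} {A i : Fin N} (hi : i ∈ interval N (A + 1) b)
    {σ : Perm (Fin N)} (hσ : σ ∈ NCPerm N A b) (hA : σ A = i) :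
    ∃ ρ ∈ NCPerm N (A + 1) i, ∃ τ ∈ NCPerm N i b, swap A i * (ρ * τ) = σ := by
  have hi' := mem_interval.1 hi
  have hσ1 := (mem_NCPerm.1 hσ).1
  have hσ2 := (mem_NCPerm.1 hσ).2
  have hI : ∀ x ∈ interval N (A + 1) i, σ x ∈ interval N (A + 1) i := by
    intro x hx
    rw [mem_interval] at hx ⊢
    have := hσ2 A x (by rw [Fin.lt_def]; omega) (by rw [hA, Fin.lt_def]; omega)
    rw [hA, Fin.lt_def, Fin.lt_def] at this
    omega
  have hval : ∀ x ∈ interval N i b, σ x ≠ i ∧ (σ x = A ∨ (σ x) ∈ interval N i b) := by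
    intro x hx
    have hxne : σ x ≠ i := fun h => by
      have := σ.injective (h.trans hA.symm)
      rw [this, mem_interval] at hx
      omega
    refine ⟨hxne, ?_⟩
    have h1 : σ x ∉ interval N (A + 1) i := fun h => by
      have := mem_of_apply_mem hI h
      rw [mem_interval] at this hx
      omega
    have h2 : σ x ∈ interval N A b := NCPerm_apply_mem hσ (by rw [mem_interval] at *; omega)
    rw [mem_interval] at *
    rw [Fin.ext_iff]
    omega
  have hJ : ∀ x ∈ interval N i b, (swap A i * σ) x ∈ interval N i b := by
    intro x hx
    obtain ⟨h1, h2⟩ := hval x hx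
    rw [Perm.mul_apply]
    by_cases h : σ x = A
    · rw [h, swap_apply_left, mem_interval]
      omega
    · rw [swap_apply_of_ne_of_ne h h1]
      exact h2.resolve_left h
  obtain ⟨ρ, hρi, hρo⟩ := exists_restrict σ _ hI
  obtain ⟨τ, hτi, hτo⟩ := exists_restrict (swap A i * σ) _ hJ
  have hτcase : ∀ x ∈ interval N i b, (σ x = A ∧ τ x = i) ∨ (σ x ≠ A ∧ τ x = σ x) := by
    intro x hx
    rw [hτi x hx, Perm.mul_apply]
    by_cases h : σ x = A
    · exact Or.inl ⟨h, by rw [h, swap_apply_left]⟩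
    · exact Or.inr ⟨h, swap_apply_of_ne_of_ne h (hval x hx).1⟩
  have hρ : ρ ∈ NCPerm N (A + 1) i := by
    rw [mem_NCPerm]
    refine ⟨hρo, fun x y hxy hyx => ?_⟩
    have hx : x ∈ interval N (A + 1) i := by
      by_contra h
      rw [hρo x h] at hyx
      exact lt_asymm hxy hyx
    rw [hρi x hx] at hyx ⊢
    have hy : y ∈ interval N (A + 1) i := by
      have := hI x hx
      rw [mem_interval] at *
      rw [Fin.lt_def] at *
      omega
    rw [hρi y hy]
    exact hσ2 x y hxy hyx
  have hτ : τ ∈ NCPerm N i b := by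
    rw [mem_NCPerm]
    refine ⟨hτo, fun x y hxy hyx => ?_⟩
    have hx : x ∈ interval N i b := by
      by_contra h
      rw [hτo x h] at hyx
      exact lt_asymm hxy hyx
    have hx' := mem_interval.1 hx
    rw [Fin.lt_def] at hxy
    rcases hτcase x hx with h | h
    · rw [h.2, Fin.lt_def] at hyx
      omega
    · rw [h.2] at hyx ⊢
      have hxv := (hval x hx).2.resolve_left h.1
      rw [mem_interval] at hxv
      have h3 := hσ2 x y hxy hyx
      rw [Fin.lt_def] at hyx
      have hy : y ∈ interval N i b := by rw [mem_interval]; omega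
      rcases hτcase y hy with h' | h'
      · rw [h'.1, Fin.lt_def] at h3
        omega
      · rw [h'.2]
        exact h3
  refine ⟨ρ, hρ, τ, hτ, ?_⟩
  ext x
  rcases swap_mul_apply_cases hi hρ hτ x with h | h | h | h | h | h
  · rw [h.2, hσ1 x (by rw [mem_interval, not_and_or]; have := h.1; rw [Fin.lt_def] at this; omega)]
  · rw [h.2, h.1, hA]
  · rw [h.2.1, hρi x h.1]
  · rw [h.2.2]
    rcases hτcase x h.1 with h' | h'
    · rw [h'.1]
    · exact absurd (h'.2.symm.trans h.2.1) (hval x h.1).1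
  · rw [h.2.1]
    rcases hτcase x h.1 with h' | h'
    · exact absurd h'.2 h.2.2.2
    · rw [h'.2]
  · rw [h.2, hσ1 x (by rw [mem_interval]; omega)]

theorem NCPerm_factors_unique {N b : ℕ} {A i : Fin N} {ρ τ ρ' τ' : Perm (Fin N)}
    (hρ : ρ ∈ NCPerm N (A + 1) i) (hτ : τ ∈ NCPerm N i b)
    (hρ' : ρ' ∈ NCPerm N (A + 1) i) (hτ' : τ' ∈ NCPerm N i b)
    (h : ρ * τ = ρ' * τ') : ρ = ρ' ∧ τ = τ' := by
  have key : ∀ {ρ τ : Perm (Fin N)}, ρ ∈ NCPerm N (A + 1) i → τ ∈ NCPerm N i b → ∀ x,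
      (x ∈ interval N i b → (ρ * τ) x = τ x) ∧ (x ∉ interval N i b → (ρ * τ) x = ρ x) := by
    intro ρ τ hρ hτ x
    refine ⟨fun hx => ?_, fun hx => ?_⟩
    · have hm := NCPerm_apply_mem hτ hx
      exact (mem_NCPerm.1 hρ).1 _ (by rw [mem_interval] at *; omega)
    · rw [Perm.mul_apply, (mem_NCPerm.1 hτ).1 x hx]
  constructor <;> ext x <;> by_cases hx : x ∈ interval N i b
  · rw [(mem_NCPerm.1 hρ).1 x (by rw [mem_interval] at *; omega),
      (mem_NCPerm.1 hρ').1 x (by rw [mem_interval] at *; omega)]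
  · rw [← (key hρ hτ x).2 hx, h, (key hρ' hτ' x).2 hx]
  · rw [← (key hρ hτ x).1 hx, h, (key hρ' hτ' x).1 hx]
  · rw [(mem_NCPerm.1 hτ).1 x hx, (mem_NCPerm.1 hτ').1 x hx]

theorem NCPerm_filter_fixed {N b : ℕ} (A : Fin N) :
    (NCPerm N A b).filter (fun σ => σ A = A) = NCPerm N (A + 1) b := by
  ext σ
  rw [Finset.mem_filter, mem_NCPerm, mem_NCPerm]
  constructor
  · rintro ⟨⟨h1, h2⟩, h3⟩
    refine ⟨fun x hx => ?_, h2⟩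
    by_cases hxA : x = A
    · rw [hxA, h3]
    · have : (x : ℕ) ≠ A := fun h => hxA (Fin.ext h)
      exact h1 x (by rw [mem_interval] at *; omega)
  · rintro ⟨h1, h2⟩
    exact ⟨⟨fun x hx => h1 x (by rw [mem_interval] at *; omega), h2⟩,
      h1 A (by rw [mem_interval]; omega)⟩

/-- Splitting the noncrossing permutations of `[a, b)` by the image `i` of `a`. -/
theorem sum_NCPerm {N b : ℕ} (A : Fin N) (hb : (A : ℕ) < b) (F : Perm (Fin N) → ℂ) :
    ∑ σ ∈ NCPerm N A b, F σ = ∑ σ ∈ NCPerm N (A + 1) b, F σ +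
      ∑ i ∈ interval N (A + 1) b, ∑ ρ ∈ NCPerm N (A + 1) i, ∑ τ ∈ NCPerm N i b,
        F (swap A i * (ρ * τ)) := by
  rw [← Finset.sum_filter_add_sum_filter_not (NCPerm N A b) (fun σ => σ A = A),
    NCPerm_filter_fixed A]
  congr 1
  rw [← Finset.sum_fiberwise_of_maps_to (t := interval N (A + 1) b) (g := fun σ => σ A)]
  · refine Finset.sum_congr rfl fun i hi => ?_
    rw [← Finset.sum_product' (f := fun ρ τ => F (swap A i * (ρ * τ)))]
    symm
    refine Finset.sum_bij (fun p _ => swap A i * (p.1 * p.2)) ?_ ?_ ?_ fun _ _ => rfl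
    · rintro ⟨ρ, τ⟩ hp
      rw [Finset.mem_product] at hp
      have hA : (swap A i * (ρ * τ)) A = i := by
        rw [Perm.mul_apply, Perm.mul_apply, (mem_NCPerm.1 hp.2).1 A, (mem_NCPerm.1 hp.1).1 A,
          swap_apply_left]
        · rw [mem_interval]; omega
        · rw [mem_interval] at *; omega
      rw [Finset.mem_filter, Finset.mem_filter]
      refine ⟨⟨swap_mul_mem_NCPerm hi hp.1 hp.2, ?_⟩, hA⟩
      simp only [hA]
      rintro rfl
      rw [mem_interval] at hi
      omega
    · rintro ⟨ρ, τ⟩ hp ⟨ρ', τ'⟩ hp' h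
      rw [Finset.mem_product] at hp hp'
      obtain ⟨rfl, rfl⟩ := NCPerm_factors_unique hp.1 hp.2 hp'.1 hp'.2 (mul_left_cancel h)
      rfl
    · intro σ hσ
      rw [Finset.mem_filter, Finset.mem_filter] at hσ
      obtain ⟨ρ, hρ, τ, hτ, h⟩ := exists_swap_mul_eq hi hσ.1.1 hσ.2
      exact ⟨(ρ, τ), Finset.mem_product.2 ⟨hρ, hτ⟩, h⟩
  · intro σ hσ
    rw [Finset.mem_filter] at hσ
    have hm := NCPerm_apply_mem hσ.1 (x := A) (by rw [mem_interval]; omega)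
    have : ((σ A : Fin N) : ℕ) ≠ A := fun h => hσ.2 (Fin.ext h)
    rw [mem_interval] at *
    omega

theorem rot_lt {N a b : ℕ} (hb : b ≤ N) (x : Fin N) :
    (if a ≤ (x : ℕ) ∧ (x : ℕ) + 1 < b then (x : ℕ) + 1
      else if a ≤ (x : ℕ) ∧ (x : ℕ) + 1 = b then a else x) < N := by
  have := x.isLt
  split_ifs <;> omega

/-- The cycle `a ↦ a + 1 ↦ ⋯ ↦ b - 1 ↦ a` on `[a, b)`. -/
noncomputable def rot {N : ℕ} (a b : ℕ) (hb : b ≤ N) : Perm (Fin N) :=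
  Equiv.ofBijective (fun x => ⟨_, rot_lt (a := a) hb x⟩) <| by
    refine Finite.injective_iff_bijective.1 fun x y hxy => ?_
    rw [Fin.mk.injEq] at hxy
    apply Fin.ext
    split_ifs at hxy <;> omega

theorem rot_apply {N a b : ℕ} (hb : b ≤ N) (x : Fin N) :
    (rot a b hb x : ℕ) = if a ≤ (x : ℕ) ∧ (x : ℕ) + 1 < b then (x : ℕ) + 1
      else if a ≤ (x : ℕ) ∧ (x : ℕ) + 1 = b then a else x := rfl

theorem rot_apply_of_notMem {N a b : ℕ} (hb : b ≤ N) {x : Fin N} (hx : x ∉ interval N a b) :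
    rot a b hb x = x := by
  rw [mem_interval] at hx
  apply Fin.ext
  rw [rot_apply]
  split_ifs <;> omega

theorem rot_apply_mem {N a b : ℕ} (hb : b ≤ N) {x : Fin N} (hx : x ∈ interval N a b) :
    rot a b hb x ∈ interval N a b := by
  rw [mem_interval] at *
  rw [rot_apply]
  split_ifs <;> omega

theorem swap_mul_rot {N b : ℕ} (hb : b ≤ N) {A i : Fin N} (hi : i ∈ interval N (A + 1) b) :
    swap A i * rot A b hb = rot A i i.isLt.le * rot i b hb := by
  rw [mem_interval] at hi
  ext x
  rw [Perm.mul_apply, Perm.mul_apply, rot_apply, rot_apply, swap_apply_def]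
  simp only [Fin.ext_iff, rot_apply, apply_ite Fin.val]
  split_ifs <;> omega

theorem rot_eq_mul_swap {N b : ℕ} (hb : b ≤ N) {A j : Fin N} (hA : (A : ℕ) + 1 < b)
    (hj : (j : ℕ) + 1 = b) : rot A b hb = rot (A + 1) b hb * swap A j := by
  ext x
  rw [Perm.mul_apply, rot_apply, rot_apply, swap_apply_def]
  simp only [Fin.ext_iff, apply_ite Fin.val]
  split_ifs <;> omega

/-- The weight of points which is `1` everywhere, except `1 + r` at `a`. -/
def mark (N a r : ℕ) : Fin N → ℕ := fun x => 1 + if (x : ℕ) = a then r else 0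

/-- The weight `f_σ g_{K(σ)}` on `[a, b)`, with the cycle of `a` enlarged by `r` and the cycle
of `b - 1` in the complement enlarged by `s`. -/
noncomputable def pairWeight (f g : ℕ → ℂ) {N : ℕ} (a b : ℕ) (hb : b ≤ N) (r s : ℕ)
    (σ : Perm (Fin N)) : ℂ :=
  cycleWeight f (mark N a r) (interval N a b) σ *
    cycleWeight g (mark N (b - 1) s) (interval N a b) (σ⁻¹ * rot a b hb)

noncomputable def pairSum (f g : ℕ → ℂ) (N a b : ℕ) (hb : b ≤ N) (r s : ℕ) : ℂ :=
  ∑ σ ∈ NCPerm N a b, pairWeight f g a b hb r s σ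

/-- The part of `pairSum` with `a` a fixed point. -/
noncomputable def fixedPairSum (f g : ℕ → ℂ) (N a b : ℕ) (hb : b ≤ N) (r s : ℕ) : ℂ :=
  ∑ σ ∈ NCPerm N (a + 1) b, pairWeight f g a b hb r s σ

theorem interval_eq_insert {N b : ℕ} {A : Fin N} (hA : (A : ℕ) < b) :
    interval N A b = insert A (interval N (A + 1) b) := by
  ext x
  rw [Finset.mem_insert, mem_interval, mem_interval, Fin.ext_iff]
  omega

theorem interval_eq_union {N a i b : ℕ} (hai : a ≤ i) (hib : i ≤ b) :
    interval N a b = interval N a i ∪ interval N i b := by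
  ext x
  rw [Finset.mem_union, mem_interval, mem_interval, mem_interval]
  omega

theorem disjoint_interval (N a i b : ℕ) : Disjoint (interval N a i) (interval N i b) := by
  rw [Finset.disjoint_left]
  intro x hx hx'
  rw [mem_interval] at *
  omega

theorem interval_succ_self {N : ℕ} (A : Fin N) : interval N A (A + 1) = {A} := by
  ext x
  rw [Finset.mem_singleton, mem_interval, Fin.ext_iff]
  omega

theorem inv_apply_mem_of_mem {N a b : ℕ} {σ : Perm (Fin N)} (hσ : σ ∈ NCPerm N a b) {x : Fin N}
    (hx : x ∈ interval N a b) : σ⁻¹ x ∈ interval N a b :=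
  mem_of_apply_mem (fun _ h => NCPerm_apply_mem hσ h) (by simpa using hx)

theorem inv_apply_of_notMem {N a b : ℕ} {σ : Perm (Fin N)} (hσ : σ ∈ NCPerm N a b) {x : Fin N}
    (hx : x ∉ interval N a b) : σ⁻¹ x = x := by
  rw [Perm.inv_eq_iff_eq, (mem_NCPerm.1 hσ).1 x hx]

theorem cycleWeight_of_fixed (f : ℕ → ℂ) {N b : ℕ} {A : Fin N} (hA : (A : ℕ) < b)
    {σ : Perm (Fin N)} (hσ : σ ∈ NCPerm N (A + 1) b) {ω ω' : Fin N → ℕ}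
    (hω : ∀ x ∈ interval N (A + 1) b, ω x = ω' x) :
    cycleWeight f ω (interval N A b) σ =
      f (ω A) * cycleWeight f ω' (interval N (A + 1) b) σ := by
  have hAf : σ A = A := (mem_NCPerm.1 hσ).1 A (by rw [mem_interval]; omega)
  rw [interval_eq_insert hA, Finset.insert_eq, cycleWeight_union f (σ := σ) (τ := σ) (ω₁ := ω)
    (ω₂ := ω') _ _ _ (fun _ _ => rfl) hω, cycleWeight_singleton f ω hAf]
  · rw [Finset.disjoint_singleton_left, mem_interval]
    omega
  · intro x hx
    rw [Finset.mem_singleton] at *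
    rw [hx]
    exact ⟨rfl, hAf⟩
  · exact fun x hx => ⟨rfl, NCPerm_apply_mem hσ hx⟩

theorem fixedPairSum_self (f g : ℕ → ℂ) {N : ℕ} (A : Fin N) (hb : (A : ℕ) + 1 ≤ N)
    (r s : ℕ) : fixedPairSum f g N A (A + 1) hb r s = f (1 + r) * g (1 + s) := by
  have h1 : NCPerm N (A + 1) (A + 1) = {1} := by
    ext σ
    rw [mem_NCPerm, Finset.mem_singleton]
    constructor
    · rintro ⟨h, -⟩
      ext x
      rw [h x (by rw [mem_interval]; omega), Perm.one_apply]
    · rintro rfl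
      exact ⟨fun _ _ => rfl, fun x y hxy hyx => absurd hxy (lt_asymm hyx)⟩
  have h2 : (1⁻¹ * rot (A : ℕ) (A + 1) hb) A = A := by
    apply Fin.ext
    rw [inv_one, one_mul, rot_apply]
    split_ifs <;> omega
  rw [fixedPairSum, h1, Finset.sum_singleton, pairWeight, interval_succ_self,
    cycleWeight_singleton f _ (Perm.one_apply A), cycleWeight_singleton g _ h2]
  simp [mark]

theorem fixedPairSum_of_lt (f g : ℕ → ℂ) {N b : ℕ} (A : Fin N) (hb : b ≤ N)
    (hA : (A : ℕ) + 1 < b) (r s : ℕ) :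
    fixedPairSum f g N A b hb r s = f (1 + r) * pairSum f g N (A + 1) b hb 0 (s + 1) := by
  rw [fixedPairSum, pairSum, Finset.mul_sum]
  refine Finset.sum_congr rfl fun σ hσ => ?_
  rw [pairWeight, pairWeight, ← mul_assoc]
  congr 1
  · rw [cycleWeight_of_fixed f (by omega) hσ (ω' := mark N (A + 1) 0)]
    · simp [mark]
    · intro x hx
      rw [mem_interval] at hx
      simp only [mark]
      split_ifs <;> omega
  · let j : Fin N := ⟨b - 1, by omega⟩
    have hj : (j : ℕ) = b - 1 := rfl
    set κ := σ⁻¹ * rot (A + 1) b hb with hκ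
    have hκA : κ A = A := by
      have hAn : A ∉ interval N (A + 1) b := by rw [mem_interval]; omega
      rw [hκ, Perm.mul_apply, rot_apply_of_notMem hb hAn, inv_apply_of_notMem hσ hAn]
    have hκI : ∀ x ∈ interval N (A + 1) b, κ x ∈ interval N (A + 1) b := fun x hx =>
      inv_apply_mem_of_mem hσ (rot_apply_mem hb hx)
    have hjI : j ∈ interval N (A + 1) b := by rw [mem_interval]; omega
    have hrw : σ⁻¹ * rot A b hb = swap A (κ j) * κ := by
      rw [rot_eq_mul_swap hb hA (j := j) (by omega), ← mul_assoc, ← hκ,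
        Equiv.mul_swap_eq_swap_mul, hκA]
    rw [hrw, interval_eq_insert (by omega)]
    refine cycleWeight_insert g (j := j) hκA ?_ (hκI j hjI) (by rw [mem_interval]; omega) hκI ?_
    · exact (Perm.SameCycle.symm ⟨1, by simp⟩)
    · intro x hx
      simp only [mark, Fin.ext_iff, hj]
      split_ifs <;> omega

/-- The first-arc decomposition of `pairSum`. -/
theorem pairSum_eq (f g : ℕ → ℂ) (hf : f 1 = 1) {N b : ℕ} (A : Fin N) (hb : b ≤ N)
    (hA : (A : ℕ) < b) (r s : ℕ) :
    pairSum f g N A b hb r s = fixedPairSum f g N A b hb r s +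
      ∑ i ∈ interval N (A + 1) b, fixedPairSum f g N A i i.isLt.le 0 0 *
        pairSum f g N i b hb (r + 1) s := by
  rw [pairSum, sum_NCPerm A hA]
  congr 1
  refine Finset.sum_congr rfl fun i hi => ?_
  have hi' := mem_interval.1 hi
  rw [fixedPairSum, pairSum, Finset.sum_mul_sum]
  refine Finset.sum_congr rfl fun ρ hρ => Finset.sum_congr rfl fun τ hτ => ?_
  have hρ1 : ∀ x ∈ interval N i b, ρ x = x := fun x hx =>
    (mem_NCPerm.1 hρ).1 x (by rw [mem_interval] at *; omega)
  have hρ2 : ∀ x ∈ interval N i b, ρ⁻¹ x = x := fun x hx =>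
    inv_apply_of_notMem hρ (by rw [mem_interval] at *; omega)
  have hAn1 : A ∉ interval N (A + 1) i := by rw [mem_interval]; omega
  have hAn2 : A ∉ interval N i b := by rw [mem_interval]; omega
  have hprod1 : ∀ x ∈ interval N (A + 1) i, (ρ * τ) x = ρ x := fun x hx => by
    rw [Perm.mul_apply, (mem_NCPerm.1 hτ).1 x (by rw [mem_interval] at *; omega)]
  have hprod2 : ∀ x ∈ interval N i b, (ρ * τ) x = τ x := fun x hx => by
    rw [Perm.mul_apply, hρ1 _ (NCPerm_apply_mem hτ hx)]
  have hfw : cycleWeight f (mark N A r) (interval N A b) (swap A i * (ρ * τ)) =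
      cycleWeight f (mark N A 0) (interval N A i) ρ *
        cycleWeight f (mark N i (r + 1)) (interval N i b) τ := by
    rw [interval_eq_insert hA, cycleWeight_insert f (j := i) (ω' := mark N i (r + 1)) _
      (Perm.SameCycle.refl _ _) hi, interval_eq_union (a := A + 1) (i := i) (by omega) (by omega),
      cycleWeight_union f (σ := ρ) (τ := τ) (ω₁ := mark N A 0) (ω₂ := mark N i (r + 1))
        (disjoint_interval _ _ _ _), cycleWeight_of_fixed f (by omega) hρ (fun _ _ => rfl)]
    · simp [mark, hf]
    · exact fun x hx => ⟨hprod1 x hx, hprod1 x hx ▸ NCPerm_apply_mem hρ hx⟩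
    · exact fun x hx => ⟨hprod2 x hx, hprod2 x hx ▸ NCPerm_apply_mem hτ hx⟩
    · intro x hx
      rw [mem_interval] at hx
      simp only [mark]
      split_ifs <;> omega
    · exact fun _ _ => rfl
    · rw [mem_interval]; omega
    · intro x hx
      rw [interval_eq_union (i := i) (by omega) (by omega), Finset.mem_union] at hx ⊢
      rcases hx with hx | hx
      · exact Or.inl (hprod1 x hx ▸ NCPerm_apply_mem hρ hx)
      · exact Or.inr (hprod2 x hx ▸ NCPerm_apply_mem hτ hx)
    · intro x hx
      rw [mem_interval] at hx
      simp only [mark, Fin.ext_iff]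
      split_ifs <;> omega
    · rw [Perm.mul_apply, (mem_NCPerm.1 hτ).1 A hAn2, (mem_NCPerm.1 hρ).1 A hAn1]
  have hgw : cycleWeight g (mark N (b - 1) s) (interval N A b)
      ((swap A i * (ρ * τ))⁻¹ * rot A b hb) =
      cycleWeight g (mark N (i - 1) 0) (interval N A i) (ρ⁻¹ * rot A i i.isLt.le) *
        cycleWeight g (mark N (b - 1) s) (interval N i b) (τ⁻¹ * rot i b hb) := by
    have hK : (swap A i * (ρ * τ))⁻¹ * rot A b hb =
        τ⁻¹ * ρ⁻¹ * (rot A i i.isLt.le * rot i b hb) := by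
      rw [mul_inv_rev, mul_inv_rev, swap_inv, mul_assoc, swap_mul_rot hb hi]
    have hρ3 : ∀ x ∈ interval N A i, ρ⁻¹ x ∈ interval N A i := by
      intro x hx
      by_cases hx' : x ∈ interval N (A + 1) i
      · have := inv_apply_mem_of_mem hρ hx'
        rw [mem_interval] at *
        omega
      · rwa [inv_apply_of_notMem hρ hx']
    have h1 : ∀ x ∈ interval N A i, (τ⁻¹ * ρ⁻¹ * (rot A i i.isLt.le * rot i b hb)) x =
        (ρ⁻¹ * rot A i i.isLt.le) x ∧ (ρ⁻¹ * rot A i i.isLt.le) x ∈ interval N A i := by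
      intro x hx
      have hm := hρ3 _ (rot_apply_mem i.isLt.le hx)
      refine ⟨?_, hm⟩
      simp only [Perm.mul_apply]
      rw [rot_apply_of_notMem hb (by rw [mem_interval] at *; omega),
        inv_apply_of_notMem hτ (by rw [mem_interval] at *; omega)]
    have h2 : ∀ x ∈ interval N i b, (τ⁻¹ * ρ⁻¹ * (rot A i i.isLt.le * rot i b hb)) x =
        (τ⁻¹ * rot i b hb) x ∧ (τ⁻¹ * rot i b hb) x ∈ interval N i b := by
      intro x hx
      have hm := rot_apply_mem hb hx
      refine ⟨?_, inv_apply_mem_of_mem hτ hm⟩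
      simp only [Perm.mul_apply]
      rw [rot_apply_of_notMem i.isLt.le (by rw [mem_interval] at *; omega), hρ2 _ hm]
    rw [hK, interval_eq_union (a := A) (i := i) (by omega) (by omega)]
    refine cycleWeight_union g (disjoint_interval _ _ _ _)
      (fun x hx => ⟨(h1 x hx).1, (h1 x hx).1 ▸ (h1 x hx).2⟩)
      (fun x hx => ⟨(h2 x hx).1, (h2 x hx).1 ▸ (h2 x hx).2⟩) ?_ fun _ _ => rfl
    intro x hx
    rw [mem_interval] at hx
    simp only [mark]
    split_ifs <;> omega
  rw [pairWeight, pairWeight, pairWeight, hfw, hgw]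
  ring

/-- `pairSum` on a chain of length `n`. -/
noncomputable def pairCoeff (f g : ℕ → ℂ) (r s n : ℕ) : ℂ :=
  if n = 0 then 0 else pairSum f g n 0 n le_rfl r s

noncomputable def fixedPairCoeff (f g : ℕ → ℂ) (r s n : ℕ) : ℂ :=
  if n = 0 then 0 else f (1 + r) * if n = 1 then g (1 + s) else pairCoeff f g 0 (s + 1) (n - 1)

theorem pairSum_eq_coeff (f g : ℕ → ℂ) (hf : f 1 = 1) (n : ℕ) (hn : 0 < n) (N a b : ℕ)
    (hb : b ≤ N) (hab : a + n = b) (r s : ℕ) :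
    pairSum f g N a b hb r s = fixedPairCoeff f g r s n +
      ∑ m ∈ Finset.Ico 1 n, fixedPairCoeff f g 0 0 m * pairCoeff f g (r + 1) s (n - m) := by
  induction n using Nat.strong_induction_on generalizing N a b r s with
  | _ n ih =>
    have hP : ∀ m, 0 < m → m < n → ∀ (N a b : ℕ) (hb : b ≤ N), a + m = b → ∀ r s : ℕ,
        pairSum f g N a b hb r s = pairCoeff f g r s m := by
      intro m hm hmn N a b hb hab r s
      rw [pairCoeff, if_neg hm.ne', ih m hmn hm N a b hb hab,
        ih m hmn hm m 0 m le_rfl (zero_add m)]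
    have hQ : ∀ m, 0 < m → m ≤ n → ∀ (N a b : ℕ) (hb : b ≤ N), a + m = b → ∀ r s : ℕ,
        fixedPairSum f g N a b hb r s = fixedPairCoeff f g r s m := by
      intro m hm hmn N a b hb hab r s
      rw [fixedPairCoeff, if_neg hm.ne']
      let A : Fin N := ⟨a, by omega⟩
      by_cases h1 : m = 1
      · subst h1
        subst hab
        rw [if_pos rfl]
        exact fixedPairSum_self f g A hb r s
      · rw [if_neg h1, fixedPairSum_of_lt f g A hb (by simp only [A]; omega),
          hP (m - 1) (by omega) (by omega) N _ b hb (by simp only [A]; omega)]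
    let A : Fin N := ⟨a, by omega⟩
    have hA : (A : ℕ) = a := rfl
    have h := pairSum_eq f g hf A hb (by omega) r s
    rw [hA] at h
    rw [h, hQ n hn le_rfl N a b hb hab]
    congr 1
    refine Finset.sum_bij (fun i _ => (i : ℕ) - a) ?_ ?_ ?_ ?_
    · intro i hi
      rw [mem_interval] at hi
      rw [Finset.mem_Ico]
      omega
    · intro i hi j hj hij
      rw [mem_interval] at hi hj
      exact Fin.ext (by omega)
    · intro m hm
      rw [Finset.mem_Ico] at hm
      refine ⟨⟨a + m, by omega⟩, ?_, by simp⟩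
      rw [mem_interval]
      simp only
      omega
    · intro i hi
      rw [mem_interval] at hi
      rw [hQ ((i : ℕ) - a) (by omega) (by omega) N a i _ (by omega),
        hP (n - ((i : ℕ) - a)) (by omega) (by omega) N i b hb (by omega)]

/-- The generating series of `pairSum`. -/
noncomputable def pairSeries (f g : ℕ → ℂ) (r s : ℕ) : PowerSeries ℂ :=
  PowerSeries.mk (pairCoeff f g r s)

noncomputable def fixedPairSeries (f g : ℕ → ℂ) (s : ℕ) : PowerSeries ℂ :=
  PowerSeries.X * (PowerSeries.C (g (1 + s)) + pairSeries f g 0 (s + 1))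

theorem mk_fixedPairCoeff (f g : ℕ → ℂ) (r s : ℕ) :
    PowerSeries.mk (fixedPairCoeff f g r s) =
      PowerSeries.C (f (1 + r)) * fixedPairSeries f g s := by
  ext n
  rw [PowerSeries.coeff_C_mul, PowerSeries.coeff_mk, fixedPairSeries, fixedPairCoeff]
  rcases n with _ | _ | n
  · simp
  · simp [PowerSeries.coeff_succ_X_mul, pairSeries, pairCoeff]
  · simp [PowerSeries.coeff_succ_X_mul, pairSeries]

theorem pairSeries_eq (f g : ℕ → ℂ) (hf : f 1 = 1) (r s : ℕ) :
    pairSeries f g r s = PowerSeries.C (f (1 + r)) * fixedPairSeries f g s +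
      fixedPairSeries f g 0 * pairSeries f g (r + 1) s := by
  have h0 : fixedPairSeries f g 0 = PowerSeries.mk (fixedPairCoeff f g 0 0) := by
    rw [mk_fixedPairCoeff, add_zero, hf, map_one, one_mul]
  rw [← mk_fixedPairCoeff, h0]
  ext n
  rw [map_add, PowerSeries.coeff_mul, Finset.Nat.sum_antidiagonal_eq_sum_range_succ_mk]
  simp only [pairSeries, PowerSeries.coeff_mk]
  rcases Nat.eq_zero_or_pos n with rfl | hn
  · simp [pairCoeff, fixedPairCoeff]
  · have h := pairSum_eq_coeff f g hf n hn n 0 n le_rfl (zero_add n) r s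
    rw [pairCoeff, if_neg hn.ne', h]
    congr 1
    rw [Finset.sum_range_succ, Nat.sub_self, Finset.range_eq_Ico,
      ← Finset.sum_Ioo_add_eq_sum_Ico hn]
    simp only [pairCoeff, fixedPairCoeff, if_true, mul_zero, zero_mul, add_zero]
    rfl

/-- The series `∑_{n ≥ 1} f_n zⁿ`. -/
noncomputable def genSeries (f : ℕ → ℂ) : PowerSeries ℂ :=
  PowerSeries.mk fun n => if n = 0 then 0 else f n

theorem genSeries_eq (f : ℕ → ℂ) :
    genSeries f = PowerSeries.X * PowerSeries.mk fun k => f (1 + k) := by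
  ext n
  cases n <;> simp [genSeries, PowerSeries.coeff_succ_X_mul, add_comm]

open PowerSeries in
theorem exists_pairSeries_factor (f g : ℕ → ℂ) (hf : f 1 = 1) :
    ∃ U H : ℂ⟦X⟧, constantCoeff U = 0 ∧ constantCoeff H = 0 ∧
      (genSeries f).subst U = pairSeries f g 0 0 ∧
      (genSeries g).subst H = pairSeries f g 0 0 ∧ U * H = X * pairSeries f g 0 0 := by
  set U := fixedPairSeries f g 0 with hU
  set Q := (mk fun k => f (1 + k)).subst U with hQ
  have hU0 : constantCoeff U = 0 := by simp [hU, fixedPairSeries]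
  have hH0 : constantCoeff (X * Q) = 0 := by simp
  have hA : ∀ s, pairSeries f g 0 s = Q * fixedPairSeries f g s := fun s =>
    eq_subst_mul_of_recursion (B := fun r => pairSeries f g r s) hU0
      (fun r => pairSeries_eq f g hf r s)
  have hV : U = (mk fun k => g (1 + k)).subst (X * Q) * X :=
    eq_subst_mul_of_recursion (B := fixedPairSeries f g) hH0 fun s => by
      rw [fixedPairSeries, hA]
      ring
  refine ⟨U, X * Q, hU0, hH0, ?_, ?_, ?_⟩
  · rw [genSeries_eq, subst_mul (hasSubst_of_constantCoeff hU0),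
      subst_X (hasSubst_of_constantCoeff hU0), hA, ← hQ, mul_comm]
  · rw [genSeries_eq, subst_mul (hasSubst_of_constantCoeff hH0),
      subst_X (hasSubst_of_constantCoeff hH0), hA, ← hU]
    conv_rhs => rw [hV]
    ring
  · rw [hA, ← hU]
    ring

/-- `φ` and `z T` are inverse to each other under composition. -/
structure IsSTransform (φ T : PowerSeries ℂ) : Prop where
  constantCoeff_eq : PowerSeries.constantCoeff φ = 0
  right_inv : φ.subst (PowerSeries.X * T) = PowerSeries.X
  left_inv : (PowerSeries.X * T).subst φ = PowerSeries.X

open PowerSeries in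
theorem X_mul_divByZ {φ : ℂ⟦X⟧} (h : constantCoeff φ = 0) : X * divByZ φ = φ := by
  ext n
  cases n <;> simp [divByZ, coeff_succ_X_mul, h]

open PowerSeries in
theorem isSTransform_divByZ {φ : ℂ⟦X⟧} (h0 : constantCoeff φ = 0) (h1 : IsUnit (coeff 1 φ)) :
    IsSTransform φ (divByZ (φ.substInvOfIsUnit h1)) := by
  have h := X_mul_divByZ (constantCoeff_substInvOfIsUnit φ h1)
  exact ⟨h0, by rw [h, subst_substInvOfIsUnit_right φ h0 h1],
    by rw [h, subst_substInvOfIsUnit_left φ h0 h1]⟩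

open PowerSeries in
theorem IsSTransform.unique {φ T T' : ℂ⟦X⟧} (h : IsSTransform φ T) (h' : IsSTransform φ T') :
    T = T' := by
  have hφ := hasSubst_of_constantCoeff h.constantCoeff_eq
  have hT : HasSubst (X * T : ℂ⟦X⟧) := hasSubst_of_constantCoeff (by simp)
  have h1 : subst (X * T : ℂ⟦X⟧) (subst φ (X * T' : ℂ⟦X⟧) : ℂ⟦X⟧) = X * T' := by
    rw [subst_comp_subst_apply hφ hT, h.right_inv, X_subst]
  rw [h'.left_inv, subst_X hT] at h1
  exact mul_left_cancel₀ (X_ne_zero (R := ℂ)) h1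

open PowerSeries in
/-- The multiplicativity of the `S`-transform. -/
theorem IsSTransform.mul {f g : ℕ → ℂ} {S T : ℂ⟦X⟧} (hf : f 1 = 1) (hg : g 1 = 1)
    (hS : IsSTransform (genSeries f) S) (hT : IsSTransform (genSeries g) T) :
    IsSTransform (pairSeries f g 0 0) (S * T) := by
  obtain ⟨U, H, hU0, hH0, hU, hH, hUH⟩ := exists_pairSeries_factor f g hf
  set φ := pairSeries f g 0 0 with hφ
  have hφ0 : constantCoeff φ = 0 := by
    rw [← coeff_zero_eq_constantCoeff_apply, hφ, pairSeries, coeff_mk, pairCoeff, if_pos rfl]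
  have hφ1 : coeff 1 φ = 1 := by
    rw [hφ, pairSeries_eq f g hf, fixedPairSeries, map_add, coeff_C_mul,
      mul_assoc, coeff_succ_X_mul, coeff_succ_X_mul]
    simp [pairSeries, pairCoeff, hf, hg]
  have hW := isSTransform_divByZ hφ0 (by rw [hφ1]; exact isUnit_one)
  set W := divByZ (φ.substInvOfIsUnit _)
  have hsW : HasSubst (X * W : ℂ⟦X⟧) := hasSubst_of_constantCoeff (by simp)
  have hsφ := hasSubst_of_constantCoeff hφ0
  have key : ∀ {h : ℕ → ℂ} {R V : ℂ⟦X⟧}, constantCoeff V = 0 → IsSTransform (genSeries h) R →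
      (genSeries h).subst V = φ → X * R = V.subst (X * W) := by
    intro h R V hV0 hR hV
    have hsV := hasSubst_of_constantCoeff hV0
    have h1 : (X * R : ℂ⟦X⟧).subst φ = V := by
      rw [← hV, ← subst_comp_subst_apply (hasSubst_of_constantCoeff hR.constantCoeff_eq) hsV,
        hR.left_inv, subst_X hsV]
    rw [← h1, subst_comp_subst_apply hsφ hsW, hW.right_inv, X_subst]
  have h1 := key hU0 hS hU
  have h2 := key hH0 hT hH
  have h3 : (X * S) * (X * T) = (X * W) * X := by
    rw [h1, h2, ← subst_mul hsW, hUH, subst_mul hsW, subst_X hsW, hW.right_inv]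
  have h4 : S * T = W := by
    apply mul_left_cancel₀ (X_ne_zero (R := ℂ))
    apply mul_left_cancel₀ (X_ne_zero (R := ℂ))
    linear_combination h3
  rw [h4]
  exact hW

theorem mem_NC {n : ℕ} {π : Finpartition (Finset.univ : Finset (Fin n))} :
    π ∈ NC n ↔ IsNoncrossing π := by
  simp [NC]

theorem mem_part_iff {n : ℕ} (π : Finpartition (Finset.univ : Finset (Fin n))) {x y : Fin n} :
    y ∈ π.part x ↔ π.part y = π.part x :=
  π.mem_part_iff_part_eq_part (Finset.mem_univ _) (Finset.mem_univ _)

theorem parts_eq_image {n : ℕ} (π : Finpartition (Finset.univ : Finset (Fin n))) :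
    π.parts = Finset.univ.image π.part := by
  ext B
  rw [Finset.mem_image]
  constructor
  · intro hB
    obtain ⟨x, hx⟩ := π.nonempty_of_mem_parts hB
    exact ⟨x, Finset.mem_univ x, π.part_eq_of_mem hB hx⟩
  · rintro ⟨x, hx, rfl⟩
    exact π.part_mem.2 hx

theorem finpartition_ext {n : ℕ} {π π' : Finpartition (Finset.univ : Finset (Fin n))}
    (h : ∀ x, π.part x = π'.part x) : π = π' := by
  apply Finpartition.ext
  rw [parts_eq_image, parts_eq_image, funext h]

open Classical in
/-- The partition into the cycles of a permutation. -/
noncomputable def cyclePartition {n : ℕ} (σ : Perm (Fin n)) :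
    Finpartition (Finset.univ : Finset (Fin n)) :=
  Finpartition.ofSetoid (Perm.SameCycle.setoid σ)

theorem part_cyclePartition {n : ℕ} (σ : Perm (Fin n)) (x : Fin n) :
    (cyclePartition σ).part x = cycleFinset σ x := by
  classical
  ext y
  rw [mem_cycleFinset, cyclePartition]
  exact Finpartition.mem_part_ofSetoid_iff_rel

theorem interval_zero_self (n : ℕ) : interval n 0 n = Finset.univ := by
  ext x
  simp [mem_interval]

theorem prod_cyclePartition (f : ℕ → ℂ) {n : ℕ} (a : ℕ) (σ : Perm (Fin n)) :
    ∏ B ∈ (cyclePartition σ).parts, f B.card = cycleWeight f (mark n a 0) (interval n 0 n) σ := by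
  rw [parts_eq_image, interval_zero_self, funext (part_cyclePartition σ), cycleWeight]
  refine Finset.prod_congr rfl fun B _ => ?_
  simp [mark]

theorem part_blockPerm {n : ℕ} (π : Finpartition (Finset.univ : Finset (Fin n))) (x : Fin n) :
    π.part (blockPerm π x) = π.part x :=
  part_formPerm π x

theorem blockPerm_next {n : ℕ} (π : Finpartition (Finset.univ : Finset (Fin n))) {x y : Fin n}
    (hy : π.part y = π.part x) (hxy : x < y) : x < blockPerm π x ∧ blockPerm π x ≤ y := by
  have hB : blockPerm π x = ((π.part x).sort (· ≤ ·)).formPerm x := rfl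
  rw [hB]
  have hs : ((π.part x).sort (· ≤ ·)).SortedLT := Finset.sortedLT_sort _
  have hx : x ∈ (π.part x).sort (· ≤ ·) := by simp
  have hy' : y ∈ (π.part x).sort (· ≤ ·) := (Finset.mem_sort _).2 ((mem_part_iff π).2 hy)
  generalize (π.part x).sort (· ≤ ·) = l at *
  obtain ⟨i, hi, rfl⟩ := List.getElem_of_mem hx
  obtain ⟨j, hj, rfl⟩ := List.getElem_of_mem hy'
  have hm := hs.strictMono_get
  have hij : i < j := by
    by_contra h
    have : l.get ⟨j, hj⟩ ≤ l.get ⟨i, hi⟩ := hm.monotone (by rw [Fin.mk_le_mk]; omega)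
    exact absurd hxy (not_lt.2 this)
  rw [List.formPerm_apply_getElem _ hs.nodup]
  have hmod : (i + 1) % l.length = i + 1 := Nat.mod_eq_of_lt (by omega)
  simp only [hmod]
  constructor
  · exact hm (a := ⟨i, hi⟩) (b := ⟨i + 1, by omega⟩) (by rw [Fin.mk_lt_mk]; omega)
  · exact hm.monotone (a := ⟨i + 1, by omega⟩) (b := ⟨j, hj⟩) (by rw [Fin.mk_le_mk]; omega)

theorem sameCycle_blockPerm {n : ℕ} (π : Finpartition (Finset.univ : Finset (Fin n)))
    {x y : Fin n} : (blockPerm π).SameCycle x y ↔ π.part x = π.part y := by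
  constructor
  · exact sameCycle_le (r := fun x y => π.part x = π.part y)
      ⟨fun _ => rfl, Eq.symm, Eq.trans⟩ fun z => (part_blockPerm π z).symm
  · intro h
    have hpow : ∀ k : ℕ, ((blockPerm π) ^ k) x =
        (((π.part x).sort (· ≤ ·)).formPerm ^ k) x ∧
        π.part (((blockPerm π) ^ k) x) = π.part x := by
      intro k
      induction k with
      | zero => exact ⟨rfl, rfl⟩
      | succ k ih =>
        refine ⟨?_, ?_⟩
        · rw [pow_succ', pow_succ', Perm.mul_apply, Perm.mul_apply, ← ih.1]
          change ((π.part (((blockPerm π) ^ k) x)).sort (· ≤ ·)).formPerm _ = _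
          rw [ih.2]
        · rw [pow_succ', Perm.mul_apply, part_blockPerm, ih.2]
    have hs : ((π.part x).sort (· ≤ ·)).SortedLT := Finset.sortedLT_sort _
    have hx : x ∈ (π.part x).sort (· ≤ ·) := by simp
    have hy' : y ∈ (π.part x).sort (· ≤ ·) :=
      (Finset.mem_sort _).2 ((mem_part_iff π).2 h.symm)
    obtain ⟨i, hi, hxi⟩ := List.getElem_of_mem hx
    obtain ⟨j, hj, hyj⟩ := List.getElem_of_mem hy'
    have key := (hpow (j + ((π.part x).sort (· ≤ ·)).length - i)).1
    generalize (π.part x).sort (· ≤ ·) = l at *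
    refine ⟨((j + l.length - i : ℕ) : ℤ), ?_⟩
    rw [zpow_natCast, key]
    subst hxi hyj
    rw [List.formPerm_pow_apply_getElem _ hs.nodup]
    congr 1
    rw [show i + (j + l.length - i) = j + l.length by omega, Nat.add_mod_right,
      Nat.mod_eq_of_lt hj]

/-- A permutation that sends every element which is not maximal in its class to the next element
of the class is determined by the classes. -/
theorem eq_of_next {n : ℕ} {r : Fin n → Fin n → Prop} (hr : Equivalence r)
    {σ τ : Perm (Fin n)} (hσ : ∀ x, r x (σ x)) (hτ : ∀ x, r x (τ x))
    (hσn : ∀ x y, r x y → x < y → x < σ x ∧ σ x ≤ y)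
    (hτn : ∀ x y, r x y → x < y → x < τ x ∧ τ x ≤ y) : σ = τ := by
  have key : ∀ x y, r x y → x < y → σ x = τ x := fun x y h hxy =>
    le_antisymm (hσn x _ (hτ x) (hτn x y h hxy).1).2 (hτn x _ (hσ x) (hσn x y h hxy).1).2
  ext1 x
  by_cases h : ∃ y, r x y ∧ x < y
  · obtain ⟨y, h1, h2⟩ := h
    exact key x y h1 h2
  · push Not at h
    obtain ⟨w, hw⟩ := τ.surjective (σ x)
    have hwx : r w x := hr.trans (hτ w) (hw ▸ hr.symm (hσ x))
    rcases (h w (hr.symm hwx)).lt_or_eq with hlt | heq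
    · have := key w x hwx hlt
      rw [hw] at this
      exact absurd (σ.injective this) hlt.ne
    · rw [← hw, heq]

theorem cyclePartition_blockPerm {n : ℕ} (π : Finpartition (Finset.univ : Finset (Fin n))) :
    cyclePartition (blockPerm π) = π := by
  refine finpartition_ext fun x => ?_
  ext y
  rw [part_cyclePartition, mem_cycleFinset, sameCycle_blockPerm, mem_part_iff, eq_comm]

theorem blockPerm_mem_NCPerm {n : ℕ} {π : Finpartition (Finset.univ : Finset (Fin n))}
    (hπ : IsNoncrossing π) : blockPerm π ∈ NCPerm n 0 n := by
  rw [mem_NCPerm, interval_zero_self]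
  refine ⟨fun x hx => absurd (Finset.mem_univ x) hx, fun x y hxy hyx => ?_⟩
  have hmem : ∀ z, z ∈ π.part z := fun z => π.mem_part (Finset.mem_univ z)
  have hpm : ∀ z, π.part z ∈ π.parts := fun z => π.part_mem.2 (Finset.mem_univ z)
  have hτ : ∀ z, blockPerm π z ∈ π.part z := fun z => (mem_part_iff π).2 (part_blockPerm π z)
  have hne : π.part y ≠ π.part x := fun h => not_le.2 hyx (blockPerm_next π h hxy).2
  have hne1 : blockPerm π y ≠ x := fun h => hne (by rw [← part_blockPerm π y, h])
  have hne2 : blockPerm π y ≠ blockPerm π x := fun h =>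
    hne (by rw [← part_blockPerm π y, h, part_blockPerm])
  constructor
  · by_contra h
    have hlt : blockPerm π y < x := lt_of_le_of_ne (not_lt.1 h) hne1
    exact hne (hπ _ (hpm y) _ (hpm x) _ _ _ _ hlt hxy hyx (hτ y) (hmem y) (hmem x) (hτ x))
  · by_contra h
    have hlt : blockPerm π x < blockPerm π y := lt_of_le_of_ne (not_lt.1 h) hne2.symm
    exact hne (hπ _ (hpm x) _ (hpm y) _ _ _ _ hxy hyx hlt (hmem x) (hτ x) (hmem y) (hτ y)).symm

theorem interval_invariant {n : ℕ} {σ : Perm (Fin n)} (hσ : σ ∈ NCPerm n 0 n) {x y z : Fin n}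
    (hxy : x < y) (hyx : y < σ x) (h : σ.SameCycle y z) : x < z ∧ z < σ x := by
  have := (sameCycle_of_agree (σ := σ) (τ := σ) (I := Finset.Ioo x (σ x)) (fun w hw => by
    rw [Finset.mem_Ioo] at hw
    exact ⟨rfl, Finset.mem_Ioo.2 ((mem_NCPerm.1 hσ).2 x w hw.1 hw.2)⟩)
    (Finset.mem_Ioo.2 ⟨hxy, hyx⟩) h).2
  exact Finset.mem_Ioo.1 this

theorem NCPerm_next {n : ℕ} {σ : Perm (Fin n)} (hσ : σ ∈ NCPerm n 0 n) {x y : Fin n}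
    (h : σ.SameCycle x y) (hxy : x < y) : x < σ x ∧ σ x ≤ y := by
  constructor
  · by_contra hle
    have hI : ∀ z ∈ (cycleFinset σ x).filter (· ≤ x),
        σ z ∈ (cycleFinset σ x).filter (· ≤ x) := by
      intro z hz
      rw [Finset.mem_filter, mem_cycleFinset] at *
      refine ⟨Perm.sameCycle_apply_right.2 hz.1, ?_⟩
      by_contra hlt
      have hzx : z ≠ x := fun h' => hlt (by rw [h']; exact not_lt.1 hle)
      exact lt_irrefl _ (interval_invariant hσ (lt_of_le_of_ne hz.2 hzx) (not_le.1 hlt)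
        hz.1).1
    have := (sameCycle_of_agree (τ := σ) (fun z hz => ⟨rfl, hI z hz⟩)
      (Finset.mem_filter.2 ⟨mem_cycleFinset.2 (Perm.SameCycle.refl σ x), le_rfl⟩) h).2
    exact not_lt.2 (Finset.mem_filter.1 this).2 hxy
  · by_contra hlt
    exact lt_irrefl _ (interval_invariant hσ hxy (not_le.1 hlt) h.symm).1

theorem isNoncrossing_cyclePartition {n : ℕ} {σ : Perm (Fin n)} (hσ : σ ∈ NCPerm n 0 n) :
    IsNoncrossing (cyclePartition σ) := by
  intro B hB C hC a b c d hab hbc hcd ha hc hb hd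
  have hpart : ∀ {B : Finset (Fin n)} {x : Fin n}, B ∈ (cyclePartition σ).parts → x ∈ B →
      B = cycleFinset σ x := fun hB hx =>
    ((cyclePartition σ).part_eq_of_mem hB hx).symm.trans (part_cyclePartition σ _)
  by_contra hne
  have hbB : b ∉ B := fun h => hne ((cyclePartition σ).eq_of_mem_parts hB hC h hb)
  obtain ⟨x, hx, hmax⟩ := (B.filter (· < b)).exists_max_image id
    ⟨a, Finset.mem_filter.2 ⟨ha, hab⟩⟩
  rw [Finset.mem_filter] at hx
  have hBx := hpart hB hx.1
  have hnext := NCPerm_next hσ (mem_cycleFinset.1 (hBx ▸ hc)) (hx.2.trans hbc)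
  have hσx : σ x ∈ B := by
    rw [hBx, mem_cycleFinset]
    exact Perm.sameCycle_apply_right.2 (Perm.SameCycle.refl σ x)
  have hbσ : b < σ x := by
    by_contra h
    have hlt : σ x < b := lt_of_le_of_ne (not_lt.1 h) fun h' => hbB (h' ▸ hσx)
    exact not_le.2 hnext.1 (hmax (σ x) (Finset.mem_filter.2 ⟨hσx, hlt⟩))
  have hdσ := (interval_invariant hσ hx.2 hbσ (mem_cycleFinset.1 (hpart hC hb ▸ hd))).2
  exact lt_irrefl _ (hdσ.trans (hnext.2.trans_lt hcd))

theorem blockPerm_cyclePartition {n : ℕ} {σ : Perm (Fin n)} (hσ : σ ∈ NCPerm n 0 n) :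
    blockPerm (cyclePartition σ) = σ := by
  have hrel : ∀ x y, (cyclePartition σ).part x = (cyclePartition σ).part y ↔
      σ.SameCycle x y := fun x y => by
    rw [part_cyclePartition, part_cyclePartition, cycleFinset_eq_iff]
  refine eq_of_next (Perm.SameCycle.equivalence σ) (fun x => ?_) (fun x => ⟨1, by simp⟩)
    (fun x y h hxy => blockPerm_next _ ((hrel _ _).2 h).symm hxy)
    (fun x y h hxy => NCPerm_next hσ h hxy)
  exact (hrel _ _).1 (part_blockPerm _ x).symm

theorem rot_zero_self (n : ℕ) : rot 0 n le_rfl = finRotate n := by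
  cases n with
  | zero => exact Subsingleton.elim _ _
  | succ n =>
    ext x
    rw [rot_apply, coe_finRotate]
    have := x.isLt
    simp only [Fin.ext_iff, Fin.val_last]
    split_ifs <;> omega

/-- Sums over `NC(n)` with Kreweras complements, in terms of noncrossing permutations. -/
theorem sum_NC_kreweras (f g : ℕ → ℂ) (n : ℕ) :
    ∑ π ∈ NC n, (∏ B ∈ π.parts, f B.card) * ∏ B ∈ (kreweras π).parts, g B.card =
      pairSum f g n 0 n le_rfl 0 0 := by
  rw [pairSum]
  refine Finset.sum_nbij' blockPerm cyclePartition ?_ ?_ ?_ ?_ ?_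
  · intro π hπ
    exact blockPerm_mem_NCPerm (mem_NC.1 hπ)
  · intro σ hσ
    exact mem_NC.2 (isNoncrossing_cyclePartition hσ)
  · exact fun π _ => cyclePartition_blockPerm π
  · exact fun σ hσ => blockPerm_cyclePartition hσ
  · intro π _
    rw [pairWeight, rot_zero_self, ← prod_cyclePartition, ← prod_cyclePartition,
      cyclePartition_blockPerm]
    rfl

open PowerSeries in
theorem IsSTransform.unique_left {φ φ' T : ℂ⟦X⟧} (h : IsSTransform φ T)
    (h' : IsSTransform φ' T) : φ = φ' := by
  have hφ := hasSubst_of_constantCoeff h'.constantCoeff_eq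
  have hT : HasSubst (X * T : ℂ⟦X⟧) := hasSubst_of_constantCoeff (by simp)
  have h1 : subst φ' (subst (X * T : ℂ⟦X⟧) φ : ℂ⟦X⟧) = φ := by
    rw [subst_comp_subst_apply hT hφ, h'.left_inv, X_subst]
  rw [h.right_inv, subst_X hφ] at h1
  exact h1.symm

theorem pairCoeff_zero (f g : ℕ → ℂ) (r s : ℕ) : pairCoeff f g r s 0 = 0 := if_pos rfl

theorem pairCoeff_one {f g : ℕ → ℂ} (hf : f 1 = 1) (hg : g 1 = 1) :
    pairCoeff f g 0 0 1 = 1 := by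
  rw [pairCoeff, if_neg one_ne_zero, pairSum_eq_coeff f g hf 1 one_pos 1 0 1 le_rfl rfl]
  simp [fixedPairCoeff, hf, hg]

theorem genSeries_pairCoeff (f g : ℕ → ℂ) :
    genSeries (pairCoeff f g 0 0) = pairSeries f g 0 0 := by
  ext n
  simp only [genSeries, pairSeries, PowerSeries.coeff_mk]
  split_ifs with h
  · rw [h, pairCoeff_zero]
  · rfl

open PowerSeries in
theorem exists_isSTransform {f : ℕ → ℂ} (hf : f 1 = 1) :
    ∃ T, constantCoeff T = 1 ∧ IsSTransform (genSeries f) T := by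
  have h0 : constantCoeff (genSeries f) = 0 := by
    rw [← coeff_zero_eq_constantCoeff_apply, genSeries, coeff_mk, if_pos rfl]
  have h1 : coeff 1 (genSeries f) = 1 := by
    rw [genSeries, coeff_mk, if_neg one_ne_zero, hf]
  have hu : IsUnit (coeff 1 (genSeries f)) := h1 ▸ isUnit_one
  refine ⟨_, ?_, isSTransform_divByZ h0 hu⟩
  rw [← coeff_zero_eq_constantCoeff_apply, divByZ, coeff_mk, zero_add,
    coeff_one_substInvOfIsUnit]
  have : hu.unit = 1 := Units.ext h1
  rw [this, inv_one, Units.val_one]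

open PowerSeries in
theorem isSTransform_one {T : ℂ⟦X⟧} (h : IsSTransform (genSeries fun _ => 1) T) :
    (1 + X) * T = 1 := by
  have hT : HasSubst (X * T : ℂ⟦X⟧) := hasSubst_of_constantCoeff (by simp)
  have h1 : genSeries (fun _ => 1) * (1 - X) = X := by
    ext n
    rw [mul_sub, mul_one, map_sub]
    rcases n with _ | _ | n
    · simp [genSeries]
    · simp [genSeries, coeff_succ_mul_X]
    · simp [genSeries, coeff_succ_mul_X, coeff_X]
  have h2 := congrArg (subst (X * T : ℂ⟦X⟧)) h1
  rw [subst_mul hT, subst_sub hT, subst_X hT, h.right_inv, ← map_one (C : ℂ →+* ℂ⟦X⟧), C_subst,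
    map_one] at h2
  apply mul_left_cancel₀ (X_ne_zero (R := ℂ))
  linear_combination -h2

theorem freeCumulant_one (μ : G1) : freeCumulant μ 1 = 1 := by
  classical
  rw [freeCumulant, Finset.sum_eq_zero, sub_zero, pow_one, μ.2.2]
  intro π hπ
  have h := (Finset.mem_filter.1 hπ).2 (π.part 0) (π.part_mem.2 (Finset.mem_univ 0))
  have : 0 < (π.part 0).card := Finset.card_pos.2 (π.part_nonempty.2 (Finset.mem_univ 0))
  omega

theorem momentSeries_eq (μ : G1) :
    momentSeries μ = pairSeries (freeCumulant μ) (fun _ => 1) 0 0 := by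
  ext n
  simp only [momentSeries, pairSeries, pairCoeff, PowerSeries.coeff_mk]
  split_ifs with h
  · rfl
  · rw [moment_eq_sum_freeCumulant μ (Nat.one_le_iff_ne_zero.2 h), ← sum_NC_kreweras]
    simp

open PowerSeries in
/-- The `S`-transform is the inverse of the `R`-transform, up to a factor `z`. -/
theorem isSTransform_sTransform (μ : G1) :
    constantCoeff (sTransform μ) = 1 ∧
      IsSTransform (genSeries (freeCumulant μ)) (sTransform μ) := by
  obtain ⟨T, hT1, hT⟩ := exists_isSTransform (freeCumulant_one μ)
  obtain ⟨R, -, hR⟩ := exists_isSTransform (f := fun _ => 1) rfl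
  have h1 := hT.mul (freeCumulant_one μ) rfl hR
  rw [← momentSeries_eq] at h1
  have h2 := h1.unique (isSTransform_divByZ h1.constantCoeff_eq (isUnit_coeff_one_momentSeries μ))
  have h3 : sTransform μ = T := by
    rw [sTransform, ← h2]
    linear_combination T * isSTransform_one hR
  rw [h3]
  exact ⟨hT1, hT⟩

/-- The character of `𝒴` with given values on the generators. -/
noncomputable def charOf (a : ℕ → ℂ) : YAlg →ₐ[ℂ] ℂ :=
  MvPolynomial.aeval fun n => a n.1

theorem charOf_congr {a b : ℕ → ℂ} (h : ∀ n, 2 ≤ n → a n = b n) : charOf a = charOf b :=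
  MvPolynomial.algHom_ext fun n => by simp [charOf, h n.1 n.2]

theorem charOf_Y {a : ℕ → ℂ} (ha : a 1 = 1) {n : ℕ} (hn : 0 < n) : charOf a (Y n) = a n := by
  rw [Y]
  split_ifs with h
  · simp [charOf]
  · rw [map_one, show n = 1 by omega, ha]

theorem charOf_Ypart {a : ℕ → ℂ} (ha : a 1 = 1) {n : ℕ}
    (π : Finpartition (Finset.univ : Finset (Fin n))) :
    charOf a (Ypart π) = ∏ B ∈ π.parts, a B.card := by
  rw [Ypart, map_prod]
  exact Finset.prod_congr rfl fun B hB =>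
    charOf_Y ha (Finset.card_pos.2 (π.nonempty_of_mem_parts hB))

theorem conv_charOf {a b : ℕ → ℂ} (ha : a 1 = 1) (hb : b 1 = 1) :
    conv (charOf a).toLinearMap (charOf b).toLinearMap =
      (charOf (pairCoeff a b 0 0)).toLinearMap := by
  have h : (Algebra.TensorProduct.lmul' ℂ).comp
      ((Algebra.TensorProduct.map (charOf a) (charOf b)).comp comul) =
      charOf (pairCoeff a b 0 0) := by
    refine MvPolynomial.algHom_ext fun n => ?_
    have hn : n.1 ≠ 0 := by have := n.2; omega
    simp only [AlgHom.comp_apply, comul, MvPolynomial.aeval_X, map_sum,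
      Algebra.TensorProduct.map_tmul, Algebra.TensorProduct.lmul'_apply_tmul, charOf_Ypart ha,
      charOf_Ypart hb]
    rw [sum_NC_kreweras, charOf, MvPolynomial.aeval_X, pairCoeff, if_neg hn]
  rw [← h]
  rfl

theorem conv_add_left (ξ ξ' η : YAlg →ₗ[ℂ] ℂ) : conv (ξ + ξ') η = conv ξ η + conv ξ' η := by
  rw [conv, TensorProduct.map_add_left, LinearMap.add_comp, LinearMap.comp_add]
  rfl

theorem conv_smul_left (c : ℂ) (ξ η : YAlg →ₗ[ℂ] ℂ) : conv (c • ξ) η = c • conv ξ η := by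
  rw [conv, TensorProduct.map_smul_left, LinearMap.smul_comp, LinearMap.comp_smul]
  rfl

theorem conv_add_right (ξ η η' : YAlg →ₗ[ℂ] ℂ) : conv ξ (η + η') = conv ξ η + conv ξ η' := by
  rw [conv, TensorProduct.map_add_right, LinearMap.add_comp, LinearMap.comp_add]
  rfl

theorem conv_sub_right (ξ η η' : YAlg →ₗ[ℂ] ℂ) : conv ξ (η - η') = conv ξ η - conv ξ η' := by
  rw [eq_sub_iff_add_eq, ← conv_add_right, sub_add_cancel]

/-- The sequence of values on generators of the convolution powers of a character. -/
noncomputable def powSeq (a : ℕ → ℂ) : ℕ → ℕ → ℂ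
  | 0 => fun n => if n = 1 then 1 else 0
  | k + 1 => pairCoeff (powSeq a k) a 0 0

theorem powSeq_one {a : ℕ → ℂ} (ha : a 1 = 1) (k : ℕ) : powSeq a k 1 = 1 := by
  induction k with
  | zero => simp [powSeq]
  | succ k ih => exact pairCoeff_one ih ha

open PowerSeries in
theorem isSTransform_X : IsSTransform (X : ℂ⟦X⟧) 1 := by
  have hX : HasSubst (X : ℂ⟦X⟧) := hasSubst_of_constantCoeff (by simp)
  refine ⟨by simp, ?_, ?_⟩ <;> rw [mul_one, subst_X hX]

theorem genSeries_powSeq_zero (a : ℕ → ℂ) : genSeries (powSeq a 0) = PowerSeries.X := by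
  ext n
  simp only [genSeries, powSeq, PowerSeries.coeff_mk, PowerSeries.coeff_X]
  split_ifs <;> simp_all

theorem isSTransform_powSeq {a : ℕ → ℂ} (ha : a 1 = 1) {S : PowerSeries ℂ}
    (hS : IsSTransform (genSeries a) S) (k : ℕ) :
    IsSTransform (genSeries (powSeq a k)) (S ^ k) := by
  induction k with
  | zero => rw [genSeries_powSeq_zero, pow_zero]; exact isSTransform_X
  | succ k ih =>
    rw [powSeq, genSeries_pairCoeff, pow_succ]
    exact ih.mul (powSeq_one ha k) ha hS

theorem counit_eq (a : ℕ → ℂ) : counit = charOf (powSeq a 0) :=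
  MvPolynomial.algHom_ext fun n => by
    have h : n.1 ≠ 1 := by have := n.2; omega
    simp [counit, charOf, powSeq, h]

theorem conv_counit {a : ℕ → ℂ} (ha : a 1 = 1) :
    conv (charOf a).toLinearMap counit.toLinearMap = (charOf a).toLinearMap := by
  rw [counit_eq a, conv_charOf ha (powSeq_one ha 0)]
  congr 1
  obtain ⟨T, -, hT⟩ := exists_isSTransform ha
  have h1 := hT.mul ha (powSeq_one ha 0) (isSTransform_powSeq ha hT 0)
  rw [pow_zero, mul_one, ← genSeries_pairCoeff] at h1
  have h2 := h1.unique_left hT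
  refine charOf_congr fun n hn => ?_
  have h3 := congrArg (PowerSeries.coeff n) h2
  simpa only [genSeries, PowerSeries.coeff_mk, if_neg (show n ≠ 0 by omega)] using h3

/-- The linear map sending `tᵏ` to the `k`-th convolution power of a character. -/
noncomputable def powFunctional (a : ℕ → ℂ) : Polynomial ℂ →ₗ[ℂ] (YAlg →ₗ[ℂ] ℂ) :=
  (Polynomial.basisMonomials ℂ).constr ℂ fun k => (charOf (powSeq a k)).toLinearMap

theorem powFunctional_monomial (a : ℕ → ℂ) (k : ℕ) (c : ℂ) :
    powFunctional a (Polynomial.monomial k c) = c • (charOf (powSeq a k)).toLinearMap := by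
  have h1 : powFunctional a (Polynomial.monomial k 1) = (charOf (powSeq a k)).toLinearMap := by
    have h := (Polynomial.basisMonomials ℂ).constr_basis ℂ
      (fun k => (charOf (powSeq a k)).toLinearMap) k
    rwa [Polynomial.coe_basisMonomials] at h
  rw [← h1, ← map_smul, Polynomial.smul_monomial, smul_eq_mul, mul_one]

theorem conv_powFunctional {a : ℕ → ℂ} (ha : a 1 = 1) (p : Polynomial ℂ) :
    conv (powFunctional a p) (counit.toLinearMap - (charOf a).toLinearMap) =
      powFunctional a (p * (1 - Polynomial.X)) := by
  induction p using Polynomial.induction_on' with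
  | add p q hp hq => rw [map_add, conv_add_left, hp, hq, ← map_add, add_mul]
  | monomial k c =>
    rw [powFunctional_monomial, conv_smul_left, conv_sub_right, conv_counit (powSeq_one ha k),
      conv_charOf (powSeq_one ha k) ha, mul_sub, mul_one, Polynomial.monomial_mul_X, map_sub,
      powFunctional_monomial, powFunctional_monomial, smul_sub]
    rfl

theorem convPow_counit_sub {a : ℕ → ℂ} (ha : a 1 = 1) (l : ℕ) :
    convPow (counit.toLinearMap - (charOf a).toLinearMap) l =
      powFunctional a ((1 - Polynomial.X) ^ l) := by
  induction l with
  | zero =>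
    rw [pow_zero, ← Polynomial.monomial_zero_one, powFunctional_monomial, one_smul,
      ← counit_eq, convPow]
  | succ l ih => rw [convPow, ih, conv_powFunctional ha, pow_succ]

open PowerSeries in
theorem powFunctional_Y {a : ℕ → ℂ} (ha : a 1 = 1) {S : ℂ⟦X⟧} (hS1 : constantCoeff S = 1)
    (hS : IsSTransform (genSeries a) S) (n : ℕ) (p : Polynomial ℂ) :
    ((n : ℂ) + 1) * powFunctional a p (Y (n + 1)) =
      coeff n (Polynomial.aeval (S⁻¹ ^ (n + 1)) p) := by
  induction p using Polynomial.induction_on' with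
  | add p q hp hq => rw [map_add, LinearMap.add_apply, mul_add, hp, hq, map_add, map_add]
  | monomial k c =>
    have hk : constantCoeff (S ^ k) = 1 := by simp [hS1]
    have hinv : (S ^ k)⁻¹ = S⁻¹ ^ k := by
      symm
      rw [eq_inv_iff_mul_eq_one (by simp [hk]), ← mul_pow,
        PowerSeries.inv_mul_cancel S (by simp [hS1]), one_pow]
    have h := coeff_of_subst_X_mul_eq_X hk (isSTransform_powSeq ha hS k).right_inv n
    rw [hinv, genSeries, coeff_mk, if_neg (Nat.succ_ne_zero n)] at h
    rw [powFunctional_monomial, LinearMap.smul_apply, AlgHom.toLinearMap_apply,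
      charOf_Y (powSeq_one ha k) n.succ_pos, Polynomial.aeval_monomial, smul_eq_mul,
      mul_left_comm, h, ← Algebra.smul_def, coeff_smul, smul_eq_mul, pow_right_comm]

theorem logFunctional_Y (η : YAlg →ₗ[ℂ] ℂ) {n : ℕ} (hn : 2 ≤ n) :
    logFunctional η (Y n) = -∑ l ∈ Finset.Icc 1 (n - 1),
      (1 / (l : ℂ)) * convPow (counit.toLinearMap - η) l (Y n) := by
  have hY : Y n = MvPolynomial.basisMonomials {n : ℕ // 2 ≤ n} ℂ
      (Finsupp.single ⟨n, hn⟩ 1) := by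
    rw [Y, dif_pos hn, MvPolynomial.coe_basisMonomials]
    rfl
  have hd : monomialDegree (Finsupp.single ⟨n, hn⟩ 1) = n - 1 := by
    simp [monomialDegree]
  conv_lhs => rw [hY, logFunctional, Module.Basis.constr_basis, hd]
  rw [hY, MvPolynomial.coe_basisMonomials]

theorem logFunctional_character_Y (μ : G1) {n : ℕ} (hn : 1 ≤ n) :
    logFunctional (character μ).toLinearMap (Y (n + 1)) =
      -PowerSeries.coeff n (PowerSeries.logOf (sTransform μ)) := by
  have ha := freeCumulant_one μ
  obtain ⟨hS1, hS⟩ := isSTransform_sTransform μ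
  have hchar : character μ = charOf (freeCumulant μ) :=
    MvPolynomial.algHom_ext fun m => by
      have : m.1 ≠ 0 := by have := m.2; omega
      simp [character, charOf, rTransform, this]
  have hn0 : ((n : ℂ) + 1) ≠ 0 := by exact_mod_cast Nat.succ_ne_zero n
  have hG : PowerSeries.constantCoeff ((sTransform μ)⁻¹ ^ (n + 1)) = 1 := by simp [hS1]
  apply mul_left_cancel₀ hn0
  rw [logFunctional_Y _ (by omega), hchar, Nat.add_sub_cancel, mul_neg, Finset.mul_sum]
  have hterm : ∀ l ∈ Finset.Icc 1 n, ((n : ℂ) + 1) * ((1 / (l : ℂ)) *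
      convPow (counit.toLinearMap - (charOf (freeCumulant μ)).toLinearMap) l (Y (n + 1))) =
      (1 / (l : ℂ)) * PowerSeries.coeff n ((1 - (sTransform μ)⁻¹ ^ (n + 1)) ^ l) := by
    intro l _
    rw [convPow_counit_sub ha, mul_left_comm, powFunctional_Y ha hS1 hS]
    simp
  rw [Finset.sum_congr rfl hterm, ← coeff_logOf hG, logOf_inv_pow hS1, map_neg,
    PowerSeries.coeff_C_mul]
  push_cast
  ring

end LSTransform

theorem theorem1p8 (μ : LSTransform.G1) :
    LSTransform.LS μ = -(PowerSeries.X * PowerSeries.logOf (LSTransform.sTransform μ)) := by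
  ext n
  rw [LSTransform.LS, PowerSeries.coeff_mk, map_neg]
  rcases n with _ | _ | n
  · simp
  · rw [if_neg (by omega), PowerSeries.coeff_succ_X_mul,
      PowerSeries.coeff_zero_eq_constantCoeff_apply,
      PowerSeries.constantCoeff_logOf (LSTransform.isSTransform_sTransform μ).1, neg_zero]
  · rw [if_pos (by omega), PowerSeries.coeff_succ_X_mul,
      LSTransform.logFunctional_character_Y μ (by omega)]
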